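/- **Setting.** For a continuous $h:\mathbb R\to[0,\infty)$ let $\Omega_h=\{(x,y)\in\mathbb R^2:0<y<h(x)\}$. For $V>0$ let $\mathcal A_V$ be the set of pairs $(u,h)$ with $h\in H^1(\mathbb R)$ (continuous representative), $h\ge 0$, $\int_{\mathbb R}h\,dx=V$, $u\in H^1(\Omega_h)$ and $u(x,0)=x$ in the sense of traces on $\{h>0\}$, and put $$F_s(V)=\inf\Big\{\int_{\Omega_h}|\nabla u|^2\,dx\,dy+\int_{\mathbb R}h'^2\,dx:\ (u,h)\in\mathcal A_V\Big\}.$$ Let $\overline V$ be the largest volume such that $F_s(W)=W$ for all $0<W\le\overline V$. For $V>\overline V$ and a pair $(u_V,h_V)\in\mathcal A_V$ that attains $F_s(V)$, let $\tilde h_V(x)=V^{-3/5}h_V(V^{2/5}x)$ be the rescaled profile. For $s>0$ with $\{\tilde h_V>s\}\neq\emptyset$ let $\tilde I_s$ be the largest connected component of $\{\tilde h_V>s\}$ (any component of maximal length, if there are several), and let $\bar h_s$ be the minimizer of $\int_{\tilde I_s}h'^2\,dx$ among the $H^1$ functions $h$ on $\tilde I_s$ with $\int_{\tilde I_s}h\,dx=\int_{\tilde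 I_s}\tilde h_V\,dx$ and $h=\tilde h_V$ on $\partial\tilde I_s$. **Proposition.** For every $\varepsilon>0$ there are constants $C_0,C_1>0$, depending only on $\varepsilon$, such that for every $V>\overline V$, every minimizer $(u_V,h_V)$ of $F_s(V)$, every $s\ge\varepsilon$ with $\{\tilde h_V>s\}\neq\emptyset$, and every such $\tilde I_s$, the minimizer $\bar h_s$ exists and $$\|\tilde h_V-\bar h_s\|_{L^2(\tilde I_s)}\le C_0\,e^{-C_1V^{1/5}}.$$ -/

import Mathlib

open MeasureTheory Set Filter Topology
open scoped ENNReal ContDiff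

noncomputable section

namespace Epitaxy

/-- `h ∈ H¹(ℝ)`, for the continuous representative `h`: it is square integrable, absolutely
continuous on every compact interval, and its (almost everywhere) derivative is square
integrable. -/
structure MemH1Line (h : ℝ → ℝ) : Prop where
  memLp : MemLp h 2 volume
  absCont : ∀ a b : ℝ, AbsolutelyContinuousOnInterval h a b
  memLp_deriv : MemLp (deriv h) 2 volume

/-- `∫_I h'² dx`. -/
def surfaceEnergyOn (I : Set ℝ) (h : ℝ → ℝ) : ℝ≥0∞ :=
  ∫⁻ x in I, ‖deriv h x‖ₑ ^ 2

/-- The surface energy `S(h) = ∫_ℝ h'² dx`. -/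
def surfaceEnergy (h : ℝ → ℝ) : ℝ≥0∞ :=
  surfaceEnergyOn univ h

/-- The region occupied by the film with height profile `h`. -/
def filmDomain (h : ℝ → ℝ) : Set (ℝ × ℝ) :=
  {z | 0 < z.2 ∧ z.2 < h z.1}

/-- `g = (∂ₓu, ∂ᵧu)` is a square integrable weak gradient of `u` on the open set `Ω`. -/
structure IsWeakGradient (Ω : Set (ℝ × ℝ)) (u : ℝ × ℝ → ℝ) (g : ℝ × ℝ → ℝ × ℝ) : Prop where
  memLp_fst : MemLp (fun z => (g z).1) 2 (volume.restrict Ω)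
  memLp_snd : MemLp (fun z => (g z).2) 2 (volume.restrict Ω)
  integral_fst : ∀ φ : ℝ × ℝ → ℝ, ContDiff ℝ ∞ φ → HasCompactSupport φ → tsupport φ ⊆ Ω →
    ∫ z in Ω, u z * fderiv ℝ φ z (1, 0) = -∫ z in Ω, (g z).1 * φ z
  integral_snd : ∀ φ : ℝ × ℝ → ℝ, ContDiff ℝ ∞ φ → HasCompactSupport φ → tsupport φ ⊆ Ω →
    ∫ z in Ω, u z * fderiv ℝ φ z (0, 1) = -∫ z in Ω, (g z).2 * φ z

/-- `u ∈ H¹(Ω)`. -/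
def MemH1Plane (Ω : Set (ℝ × ℝ)) (u : ℝ × ℝ → ℝ) : Prop :=
  MemLp u 2 (volume.restrict Ω) ∧ ∃ g, IsWeakGradient Ω u g

/-- The Dirichlet energy `∫_Ω |∇u|² dx dy`. The weak gradient of a function of `H¹(Ω)` is unique
almost everywhere on `Ω`, so that the infimum runs over a single value. -/
def dirichletEnergy (Ω : Set (ℝ × ℝ)) (u : ℝ × ℝ → ℝ) : ℝ≥0∞ :=
  ⨅ (g : ℝ × ℝ → ℝ × ℝ) (_ : IsWeakGradient Ω u g),
    ∫⁻ z in Ω, ENNReal.ofReal ((g z).1 ^ 2 + (g z).2 ^ 2)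

/-- The boundary condition `u(x, 0) = x` on the base of the film, in the sense of traces: for
almost every `x` with `h x > 0`, the averages of `|u(x, ·) - x|` over the vertical segments
`(0, δ)` tend to zero as `δ → 0⁺`. (For `u ∈ H¹` and almost every such `x`, the function `u(x, ·)`
agrees almost everywhere with an absolutely continuous function on `[0, h x)`; the condition says
that the value of the latter at `0` is `x`.) -/
def HasMisfitTrace (h : ℝ → ℝ) (u : ℝ × ℝ → ℝ) : Prop :=
  ∀ᵐ x : ℝ, 0 < h x →
    Tendsto (fun δ : ℝ => δ⁻¹ * ∫ y in (0 : ℝ)..δ, |u (x, y) - x|) (𝓝[>] 0) (𝓝 0)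

/-- `(u, h) ∈ 𝒜_V`. -/
structure Admissible (V : ℝ) (u : ℝ × ℝ → ℝ) (h : ℝ → ℝ) : Prop where
  profile_memH1 : MemH1Line h
  profile_nonneg : ∀ x, 0 ≤ h x
  profile_integrable : Integrable h
  profile_volume : ∫ x, h x = V
  memH1 : MemH1Plane (filmDomain h) u
  trace : HasMisfitTrace h u

/-- `E(u, h) + S(h)`. -/
def totalEnergy (u : ℝ × ℝ → ℝ) (h : ℝ → ℝ) : ℝ≥0∞ :=
  dirichletEnergy (filmDomain h) u + surfaceEnergy h

/-- The minimal energy `F_s(V)` in the small slope approximation. -/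
def minEnergy (V : ℝ) : ℝ≥0∞ :=
  ⨅ (u : ℝ × ℝ → ℝ) (h : ℝ → ℝ) (_ : Admissible V u h), totalEnergy u h

/-- The pair `(u, h) ∈ 𝒜_V` attains `F_s(V)`. -/
def IsEnergyMinimizer (V : ℝ) (u : ℝ × ℝ → ℝ) (h : ℝ → ℝ) : Prop :=
  Admissible V u h ∧ totalEnergy u h = minEnergy V

/-- The critical volume `V̄`: the largest `V` such that `F_s(W) = W` for all `0 < W ≤ V`. -/
def criticalVolume : ℝ :=
  sSup {V : ℝ | 0 < V ∧ ∀ W, 0 < W → W ≤ V → minEnergy W = ENNReal.ofReal W}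

/-- The rescaled profile `h̃(x) = V^{-3/5} h(V^{2/5} x)`. -/
def rescaledProfile (V : ℝ) (h : ℝ → ℝ) (x : ℝ) : ℝ :=
  V ^ (-(3 / 5) : ℝ) * h (V ^ (2 / 5 : ℝ) * x)

/-- `I` is a connected component of `{f > s}` of maximal length. -/
def IsLargestComponent (f : ℝ → ℝ) (s : ℝ) (I : Set ℝ) : Prop :=
  (∃ x, s < f x ∧ I = connectedComponentIn {y | s < f y} x) ∧
    ∀ x, s < f x → volume (connectedComponentIn {y | s < f y} x) ≤ volume I

/-- `k` competes with `f` on the bounded open interval `I`: it is of class `H¹` (functions of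
`H¹(I)` being the restrictions to `I` of functions of `H¹(ℝ)`), has the same boundary values, and
the same integral over `I`. -/
structure IsCompetitorOn (f : ℝ → ℝ) (I : Set ℝ) (k : ℝ → ℝ) : Prop where
  memH1 : MemH1Line k
  boundary : ∀ x ∈ frontier I, k x = f x
  integral_eq : ∫ x in I, k x = ∫ x in I, f x

/-- `k` minimizes `∫_I k'² dx` among all competitors of `f` on `I`; only the values of `k` on
`I` matter, and there they are determined. -/
def IsConstrainedMinimizerOn (f : ℝ → ℝ) (I : Set ℝ) (k : ℝ → ℝ) : Prop :=
  IsCompetitorOn f I k ∧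
    ∀ k', IsCompetitorOn f I k' → surfaceEnergyOn I k ≤ surfaceEnergyOn I k'

end Epitaxy

end

namespace Epitaxy

/-! ### One-dimensional Sobolev functions -/

/-! The film stores exponentially little elastic energy at heights of order `V^{3/5}`, so there the
profile minimizes the surface energy almost on its own.

One-dimensional part. A component of `{f > s}`, for the rescaled profile `f` of integral one, is an
interval `(a, b)` of length at most `1 / s` with `f = s` at both ends (`component_superlevel`). The
constrained minimizer is the parabola `p` with these boundary values and the right integral: since
`p''` is constant, `p'` is orthogonal to `f' - p'`, so the energy of `f` exceeds that of `p` by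
exactly `D = ∫ |f' - p'|²` (`surfaceEnergyOn_eq_parabola_add`). By Poincaré's inequality the squared
`L²` distance is at most `(b - a)² D`. It remains to bound `D`.

Decay. Let `k` be a profile of volume `V` which differs from `h` only where both are at least `s`,
let `X = S(h) - S(k)`, and let `E(t)` be the Dirichlet energy of `u` above the height `t < s`. A
competitor for `(u, h)` is obtained by keeping `u` below `t` and, above `t`, letting its trace on
the line `y = t` relax exponentially in `y` to a constant on each component of `{h > t}`
(`exists_competitor`). If `{h > t}` has length at most `Λ`, the relaxation costs at most `Λ ∫
|∂ₓu(x, t)|² dx`, once more by Poincaré's inequality. Minimality gives `E(t) + X ≤ Λ ∫ |∂ₓu(x, t)|²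
dx ≤ -Λ E'(t)`, and Grönwall's inequality on `[s/2, s]` with `Λ = 2V / s` gives `X exp(s² / (4V)) ≤
F_s(V)` (`IsEnergyMinimizer.excess_le`).

Scaling. The test pair with `u(x, y) = x` and a dilated bump gives `F_s(V) ≤ C V`
(`exists_minEnergy_le`). With `T = V^{1/5}`, the rescaled height `s` is the height `T³ s` and `X =
T⁴ D`, so that `D ≤ C T exp(-s² T / 4)`; half of the exponential absorbs the factor `T`.

Making the cut rigorous with weak gradients requires that almost every horizontal line carry a weak
derivative and Green's formula for all test functions at once (`PlaneSobolev.ae_goodSlice`). -/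

theorem sq_lintegral_le_measure_mul {α : Type*} [MeasurableSpace α] (μ : Measure α)
    {f : α → ℝ≥0∞} (hf : AEMeasurable f μ) :
    (∫⁻ x, f x ∂μ) ^ 2 ≤ μ univ * ∫⁻ x, f x ^ 2 ∂μ := by
  have h := ENNReal.lintegral_mul_le_Lp_mul_Lq μ Real.HolderConjugate.two_two
    (aemeasurable_const (b := (1 : ℝ≥0∞))) hf
  simp only [Pi.mul_apply, one_mul, ENNReal.one_rpow, lintegral_const] at h
  have h2 := pow_le_pow_left' h 2
  refine h2.trans (le_of_eq ?_)
  rw [mul_pow, ← ENNReal.rpow_natCast, ← ENNReal.rpow_mul, ← ENNReal.rpow_natCast,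
    ← ENNReal.rpow_mul]
  norm_num

theorem MemH1Line.continuous {f : ℝ → ℝ} (hf : MemH1Line f) : Continuous f := by
  refine continuous_iff_continuousAt.2 fun x => ?_
  refine (hf.absCont (x - 1) (x + 1)).continuousOn.continuousAt ?_
  rw [uIcc_of_le (by linarith)]
  exact Icc_mem_nhds (by linarith) (by linarith)

theorem MemH1Line.intervalIntegrable_deriv {f : ℝ → ℝ} (hf : MemH1Line f) (a b : ℝ) :
    IntervalIntegrable (deriv f) volume a b :=
  (hf.absCont a b).intervalIntegrable_deriv

theorem MemH1Line.integral_deriv {f : ℝ → ℝ} (hf : MemH1Line f) (a b : ℝ) :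
    ∫ x in a..b, deriv f x = f b - f a :=
  (hf.absCont a b).integral_deriv_eq_sub

/-- Glued and rescaled profiles are shown to be absolutely continuous by exhibiting them as
primitives of an explicit candidate derivative. -/
theorem absolutelyContinuousOnInterval_of_eq_integral {q q' : ℝ → ℝ} {c : ℝ}
    (hq' : ∀ a b, IntervalIntegrable q' volume a b)
    (h : ∀ x, q x = q c + ∫ y in c..x, q' y) (a b : ℝ) :
    AbsolutelyContinuousOnInterval q a b := by
  set A := min (min a b) c
  set B := max (max a b) c
  have hA : A ≤ min a b := min_le_left _ _
  have hB : max a b ≤ B := le_max_left _ _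
  have hAc : A ≤ c := min_le_right _ _
  have hcB : c ≤ B := le_max_right _ _
  have h1 := (hq' A B).absolutelyContinuousOnInterval_intervalIntegral (c := c)
    (by rw [uIcc_of_le (hAc.trans hcB)]; exact ⟨hAc, hcB⟩)
  have h2 : AbsolutelyContinuousOnInterval (fun _ : ℝ => q c) A B :=
    (LipschitzWith.const (q c)).lipschitzOnWith.absolutelyContinuousOnInterval
  have h3 := h2.add h1
  have h4 : q = (fun _ : ℝ => q c) + fun x => ∫ y in c..x, q' y := by
    funext x; exact h x
  rw [← h4] at h3
  refine h3.mono ?_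
  rw [uIcc_of_le (hAc.trans hcB)]
  exact Icc_subset_Icc hA hB

theorem surfaceEnergyOn_eq_ofReal {I : Set ℝ} {k : ℝ → ℝ}
    (hk : MemLp (deriv k) 2 (volume.restrict I)) :
    surfaceEnergyOn I k = ENNReal.ofReal (∫ x in I, deriv k x ^ 2) := by
  rw [ofReal_integral_eq_lintegral_ofReal hk.integrable_sq
    (Eventually.of_forall fun x => sq_nonneg _)]
  unfold surfaceEnergyOn
  refine lintegral_congr fun x => ?_
  rw [← ofReal_norm, ← ENNReal.ofReal_pow (norm_nonneg _), Real.norm_eq_abs, sq_abs]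

theorem surfaceEnergy_ne_top {f : ℝ → ℝ} (hf : MemH1Line f) : surfaceEnergy f ≠ ⊤ := by
  unfold surfaceEnergy
  rw [surfaceEnergyOn_eq_ofReal (by simpa using hf.memLp_deriv)]
  exact ENNReal.ofReal_ne_top

theorem surfaceEnergyOn_ne_top {f : ℝ → ℝ} (hf : MemH1Line f) (I : Set ℝ) :
    surfaceEnergyOn I f ≠ ⊤ := by
  rw [surfaceEnergyOn_eq_ofReal (hf.memLp_deriv.restrict I)]
  exact ENNReal.ofReal_ne_top

theorem surfaceEnergy_eq_add_compl {I : Set ℝ} (hI : MeasurableSet I) (f : ℝ → ℝ) :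
    surfaceEnergy f = surfaceEnergyOn I f + surfaceEnergyOn Iᶜ f := by
  unfold surfaceEnergy surfaceEnergyOn
  rw [Measure.restrict_univ, lintegral_add_compl _ hI]

/-- A Sobolev function which vanishes at the left end of an interval is controlled by its
derivative. -/
theorem lintegral_sq_le_of_integral_eq {a b : ℝ} {q q' : ℝ → ℝ}
    (hq' : AEMeasurable q' (volume.restrict (Ioo a b)))
    (h : ∀ x ∈ Ioo a b, q x = ∫ y in a..x, q' y) :
    ∫⁻ x in Ioo a b, ‖q x‖ₑ ^ 2 ≤
      ENNReal.ofReal ((b - a) ^ 2) * ∫⁻ x in Ioo a b, ‖q' x‖ₑ ^ 2 := by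
  have key : ∀ x ∈ Ioo a b, ‖q x‖ₑ ^ 2 ≤
      ENNReal.ofReal (b - a) * ∫⁻ x in Ioo a b, ‖q' x‖ₑ ^ 2 := by
    intro x hx
    have h1 : ‖q x‖ₑ ≤ ∫⁻ y in Ioo a b, ‖q' y‖ₑ := by
      rw [h x hx, intervalIntegral.integral_of_le hx.1.le]
      refine (enorm_integral_le_lintegral_enorm _).trans ?_
      exact lintegral_mono_set fun y hy => ⟨hy.1, hy.2.trans_lt hx.2⟩
    refine (pow_le_pow_left' h1 2).trans ?_
    refine (sq_lintegral_le_measure_mul _ hq'.enorm).trans (le_of_eq ?_)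
    rw [Measure.restrict_apply_univ, Real.volume_Ioo]
  refine (setLIntegral_mono' measurableSet_Ioo key).trans (le_of_eq ?_)
  rw [setLIntegral_const, Real.volume_Ioo]
  rcases le_total a b with hab | hab
  · rw [sq, ENNReal.ofReal_mul (by linarith)]; ring
  · simp [Ioo_eq_empty_of_le hab]

/-! ### Gluing a parabola into a profile -/

/-- The profile `f` with its values on `(a, b)` replaced by those of `p`. -/
noncomputable def glue (a b : ℝ) (p f : ℝ → ℝ) : ℝ → ℝ := (Ioo a b).piecewise p f

theorem glue_eq_left {a b : ℝ} {p f : ℝ → ℝ} {x : ℝ} (hx : x ∈ Ioo a b) :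
    glue a b p f x = p x := piecewise_eq_of_mem _ _ _ hx

theorem glue_eq_right {a b : ℝ} {p f : ℝ → ℝ} {x : ℝ} (hx : x ∉ Ioo a b) :
    glue a b p f x = f x := piecewise_eq_of_notMem _ _ _ hx

theorem deriv_glue_of_mem {a b : ℝ} {p f : ℝ → ℝ} {x : ℝ} (hx : x ∈ Ioo a b) :
    deriv (glue a b p f) x = deriv p x := by
  refine Filter.EventuallyEq.deriv_eq ?_
  filter_upwards [isOpen_Ioo.mem_nhds hx] with y hy using glue_eq_left hy

theorem deriv_glue_of_notMem {a b : ℝ} {p f : ℝ → ℝ} {x : ℝ} (hx : x ∉ Icc a b) :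
    deriv (glue a b p f) x = deriv f x := by
  refine Filter.EventuallyEq.deriv_eq ?_
  filter_upwards [isClosed_Icc.isOpen_compl.mem_nhds hx] with y hy
    using glue_eq_right fun h => hy (Ioo_subset_Icc_self h)

theorem ae_mem_Ioo_or_notMem_Icc (a b : ℝ) : ∀ᵐ x : ℝ, x ∈ Ioo a b ∨ x ∉ Icc a b := by
  have h : ∀ᵐ x : ℝ, x ∉ ({a, b} : Set ℝ) :=
    measure_eq_zero_iff_ae_notMem.1 ((Set.toFinite _).measure_zero _)
  filter_upwards [h] with x hx
  simp only [mem_insert_iff, mem_singleton_iff, not_or] at hx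
  by_cases hI : x ∈ Icc a b
  · exact Or.inl ⟨lt_of_le_of_ne hI.1 (Ne.symm hx.1), lt_of_le_of_ne hI.2 hx.2⟩
  · exact Or.inr hI

/-- Because `p` and `f` agree at `a` and `b`, there is no jump: the primitive of the piecewise
derivative reproduces the glued function on all three pieces. -/
theorem MemH1Line.glue {a b : ℝ} (hab : a < b) {p f : ℝ → ℝ} (hf : MemH1Line f)
    (hp : ContDiff ℝ 1 p) (ha : p a = f a) (hb : p b = f b) : MemH1Line (glue a b p f) := by
  classical
  have hpd : Continuous (deriv p) := hp.continuous_deriv (by norm_num)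
  have mp : ∀ g : ℝ → ℝ, Continuous g → MemLp g 2 (volume.restrict (Ioo a b)) := by
    intro g hg
    obtain ⟨C, hC⟩ := isCompact_Icc.exists_bound_of_continuousOn (s := Icc a b) hg.continuousOn
    refine MemLp.of_bound hg.aestronglyMeasurable C ?_
    filter_upwards [ae_restrict_mem measurableSet_Ioo] with x hx
      using hC x (Ioo_subset_Icc_self hx)
  set k' : ℝ → ℝ := (Ioo a b).piecewise (deriv p) (deriv f) with hk'
  have hae : deriv (Epitaxy.glue a b p f) =ᵐ[volume] k' := by
    filter_upwards [ae_mem_Ioo_or_notMem_Icc a b] with x hx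
    rcases hx with hx | hx
    · rw [deriv_glue_of_mem hx, hk', piecewise_eq_of_mem _ _ _ hx]
    · rw [deriv_glue_of_notMem hx, hk',
        piecewise_eq_of_notMem _ _ _ fun h => hx (Ioo_subset_Icc_self h)]
  have hk'm : MemLp k' 2 volume :=
    MemLp.piecewise measurableSet_Ioo (mp _ hpd) (hf.memLp_deriv.restrict _)
  have hk'i : ∀ c d, IntervalIntegrable k' volume c d := fun c d =>
    ⟨(hk'm.restrict _).integrable (by norm_num), (hk'm.restrict _).integrable (by norm_num)⟩
  have ga : Epitaxy.glue a b p f a = f a := glue_eq_right (by simp)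
  have gb : Epitaxy.glue a b p f b = f b := glue_eq_right (by simp)
  have e1 : ∀ x ∈ Icc a b, ∫ y in a..x, k' y = p x - p a := by
    intro x hx
    rw [← intervalIntegral.integral_deriv_eq_sub (fun y _ => hp.differentiable (by norm_num) y)
      (hpd.intervalIntegrable _ _)]
    refine intervalIntegral.integral_congr_ae ?_
    filter_upwards [ae_mem_Ioo_or_notMem_Icc a b] with y hy hyx
    rw [uIoc_of_le hx.1] at hyx
    rcases hy with hy | hy
    · rw [hk', piecewise_eq_of_mem _ _ _ hy]
    · exact absurd ⟨hyx.1.le, hyx.2.trans hx.2⟩ hy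
  have e2 : ∀ c d, c ≤ d → (d ≤ a ∨ b ≤ c) → ∫ y in c..d, k' y = f d - f c := by
    intro c d hcd h
    rw [← hf.integral_deriv]
    refine intervalIntegral.integral_congr_ae ?_
    filter_upwards [ae_mem_Ioo_or_notMem_Icc a b] with y hy hyx
    rw [uIoc_of_le hcd] at hyx
    rw [hk', piecewise_eq_of_notMem]
    rintro ⟨h1, h2⟩
    rcases h with h | h <;> linarith [hyx.1, hyx.2]
  refine ⟨MemLp.piecewise measurableSet_Ioo (mp _ hp.continuous) (hf.memLp.restrict _),
    absolutelyContinuousOnInterval_of_eq_integral (c := a) hk'i ?_, (memLp_congr_ae hae).2 hk'm⟩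
  intro x
  rw [ga]
  rcases lt_or_ge x a with hx | hx
  · rw [glue_eq_right (by simp [hx.le]), intervalIntegral.integral_symm,
      e2 x a hx.le (Or.inl le_rfl)]
    ring
  rcases le_or_gt x b with hxb | hxb
  · rw [e1 x ⟨hx, hxb⟩]
    rcases hx.eq_or_lt with rfl | hx
    · rw [ga]; ring
    rcases hxb.eq_or_lt with rfl | hxb
    · rw [gb]; linarith
    · rw [glue_eq_left ⟨hx, hxb⟩]; linarith
  · rw [glue_eq_right (by simp [hxb.le]),
      ← intervalIntegral.integral_add_adjacent_intervals (hk'i a b) (hk'i b x),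
      e1 b ⟨hab.le, le_rfl⟩, e2 b x hxb.le (Or.inr le_rfl)]
    linarith

/-- The parabola with value `s` at `a` and `b`, and leading coefficient `-c`. -/
noncomputable def parabola (a b s c : ℝ) (x : ℝ) : ℝ := s + c * ((x - a) * (b - x))

theorem contDiff_parabola (a b s c : ℝ) : ContDiff ℝ ∞ (parabola a b s c) := by
  unfold parabola; fun_prop

theorem hasDerivAt_parabola (a b s c x : ℝ) :
    HasDerivAt (parabola a b s c) (c * (a + b - 2 * x)) x := by
  have := ((((hasDerivAt_id x).sub_const a).mul ((hasDerivAt_id x).const_sub b)).const_mul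
    c).const_add s
  convert! this using 1
  simp only [id]
  ring

theorem deriv_parabola (a b s c : ℝ) :
    deriv (parabola a b s c) = fun x => c * (a + b - 2 * x) :=
  funext fun x => (hasDerivAt_parabola a b s c x).deriv

theorem integral_parabola {a b : ℝ} (s c : ℝ) :
    ∫ x in a..b, parabola a b s c x = s * (b - a) + c * ((b - a) ^ 3 / 6) := by
  have : ∀ x ∈ uIcc a b, HasDerivAt
      (fun x => s * x + c * (-(x ^ 3 / 3) + (a + b) * (x ^ 2 / 2) - a * b * x))
      (parabola a b s c x) x := by
    intro x _
    have h := ((hasDerivAt_id x).const_mul s).add ((((((hasDerivAt_id x).pow 3).div_const 3).neg.add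
      ((((hasDerivAt_id x).pow 2).div_const 2).const_mul (a + b))).sub
      ((hasDerivAt_id x).const_mul (a * b))).const_mul c)
    convert! h using 1
    simp only [id, parabola]
    push_cast
    ring
  rw [intervalIntegral.integral_eq_sub_of_hasDerivAt this
    ((contDiff_parabola a b s c).continuous.intervalIntegrable _ _)]
  ring

/-- Among the functions with the same boundary values and integral, the parabola minimizes the
surface energy. -/
theorem surfaceEnergyOn_eq_parabola_add {a b s c : ℝ} (hab : a < b) {k : ℝ → ℝ}
    (hk : MemH1Line k) (ha : k a = s) (hb : k b = s)
    (hint : ∫ x in Ioo a b, k x = ∫ x in Ioo a b, parabola a b s c x) :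
    surfaceEnergyOn (Ioo a b) k = surfaceEnergyOn (Ioo a b) (parabola a b s c) +
      ∫⁻ x in Ioo a b, ‖deriv k x - deriv (parabola a b s c) x‖ₑ ^ 2 := by
  set p := parabola a b s c with hp
  have hpc : ContDiff ℝ ∞ p := contDiff_parabola a b s c
  have hpd : Continuous (deriv p) := hpc.continuous_deriv (by simp)
  have hp1 : MemLp (deriv p) 2 (volume.restrict (Ioo a b)) := by
    obtain ⟨C, hC⟩ := isCompact_Icc.exists_bound_of_continuousOn (s := Icc a b) hpd.continuousOn
    refine MemLp.of_bound hpd.aestronglyMeasurable C ?_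
    filter_upwards [ae_restrict_mem measurableSet_Ioo] with x hx
      using hC x (Ioo_subset_Icc_self hx)
  have hk1 : MemLp (deriv k) 2 (volume.restrict (Ioo a b)) := hk.memLp_deriv.restrict _
  have hq1 : MemLp (fun x => deriv k x - deriv p x) 2 (volume.restrict (Ioo a b)) := hk1.sub hp1
  -- Integration by parts: the boundary terms vanish since `k = p` at the ends, and `p''` is the
  -- constant `-2c`, which is multiplied by `∫ (k - p) = 0`.
  have cross : ∫ x in Ioo a b, deriv p x * (deriv k x - deriv p x) = 0 := by
    have hac : ∀ g : ℝ → ℝ, ContDiff ℝ ∞ g → AbsolutelyContinuousOnInterval g a b := fun g hg =>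
      (hg.of_le (by simp)).contDiffOn.absolutelyContinuousOnInterval
    have i1 := (hac (deriv p) (by rw [hp, deriv_parabola]; fun_prop)
      ).integral_mul_deriv_eq_deriv_mul (hk.absCont a b)
    have i2 := (hac (deriv p) (by rw [hp, deriv_parabola]; fun_prop)
      ).integral_mul_deriv_eq_deriv_mul (hac p hpc)
    have hdd : ∀ x, deriv (deriv p) x = -2 * c := by
      intro x
      rw [hp, deriv_parabola]
      have := ((((hasDerivAt_id x).const_mul 2).const_sub (a + b)).const_mul c).deriv
      simp only [id] at this
      rw [this]; ring
    simp only [hdd, intervalIntegral.integral_const_mul] at i1 i2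
    rw [intervalIntegral.integral_of_le hab.le, integral_Ioc_eq_integral_Ioo,
      intervalIntegral.integral_of_le hab.le, integral_Ioc_eq_integral_Ioo] at i1 i2
    have e : ∀ x, deriv p x * (deriv k x - deriv p x) = deriv p x * deriv k x
        - deriv p x * deriv p x := fun x => by ring
    simp only [e]
    have s1 := integral_sub (hp1.integrable_mul hk1) (hp1.integrable_mul hp1)
    simp only [Pi.mul_apply] at s1
    rw [s1, i1, i2, hint, ha, hb]
    simp [hp, parabola]
  have e3 : ∫⁻ x in Ioo a b, ‖deriv k x - deriv p x‖ₑ ^ 2 =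
      ENNReal.ofReal (∫ x in Ioo a b, (deriv k x - deriv p x) ^ 2) := by
    rw [ofReal_integral_eq_lintegral_ofReal hq1.integrable_sq
      (Eventually.of_forall fun x => sq_nonneg _)]
    refine lintegral_congr fun x => ?_
    rw [← ofReal_norm, ← ENNReal.ofReal_pow (norm_nonneg _), Real.norm_eq_abs, sq_abs]
  rw [surfaceEnergyOn_eq_ofReal hk1, surfaceEnergyOn_eq_ofReal hp1, e3,
    ← ENNReal.ofReal_add (integral_nonneg fun x => sq_nonneg _)
      (integral_nonneg fun x => sq_nonneg _)]
  congr 1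
  rw [← integral_add hp1.integrable_sq hq1.integrable_sq]
  have e : ∀ x, deriv k x ^ 2 = (deriv p x ^ 2 + (deriv k x - deriv p x) ^ 2) +
      2 * (deriv p x * (deriv k x - deriv p x)) := fun x => by ring
  simp only [e]
  have s1 := integral_add (hp1.integrable_sq.add hq1.integrable_sq)
    ((hp1.integrable_mul hq1).const_mul 2)
  simp only [Pi.mul_apply, Pi.add_apply] at s1
  rw [s1, integral_const_mul, cross]
  simp

/-- The constrained minimizer on an interval on whose ends `f` takes its minimal value `s`. -/
theorem exists_glued_minimizer {f : ℝ → ℝ} (hf : MemH1Line f) {a b s : ℝ} (hab : a < b)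
    (ha : f a = s) (hb : f b = s) (hs : ∀ x ∈ Ioo a b, s ≤ f x) :
    ∃ k : ℝ → ℝ, IsCompetitorOn f (Ioo a b) k ∧ (∀ x ∉ Ioo a b, k x = f x) ∧
      (∀ x ∈ Ioo a b, s ≤ k x) ∧
      surfaceEnergyOn (Ioo a b)ᶜ k = surfaceEnergyOn (Ioo a b)ᶜ f ∧
      ∀ g, IsCompetitorOn f (Ioo a b) g → ∃ D : ℝ≥0∞,
        surfaceEnergyOn (Ioo a b) g = surfaceEnergyOn (Ioo a b) k + D ∧
        ∫⁻ x in Ioo a b, ‖g x - k x‖ₑ ^ 2 ≤ ENNReal.ofReal ((b - a) ^ 2) * D := by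
  have hba : 0 < b - a := sub_pos.2 hab
  -- Since `∫ (x - a)(b - x) = (b - a)³ / 6`, this coefficient gives the parabola the same integral
  -- as `f`.
  set c : ℝ := 6 / (b - a) ^ 3 * ∫ x in Ioo a b, (f x - s) with hc
  have hfi : IntegrableOn f (Ioo a b) :=
    (hf.continuous.integrableOn_Icc (a := a) (b := b)).mono_set Ioo_subset_Icc_self
  have hint : ∫ x in Ioo a b, parabola a b s c x = ∫ x in Ioo a b, f x := by
    have h1 := integral_parabola (a := a) (b := b) s c
    rw [intervalIntegral.integral_of_le hab.le, integral_Ioc_eq_integral_Ioo] at h1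
    rw [h1, hc, integral_sub hfi (integrable_const s)]
    simp [hab.le]
    field_simp
    ring
  -- The parabola is therefore concave and stays above `s`, so that gluing it in does not disturb
  -- the film below the height `s`.
  have hc0 : 0 ≤ c := by
    refine mul_nonneg (by positivity) (setIntegral_nonneg measurableSet_Ioo fun x hx => ?_)
    linarith [hs x hx]
  have hgi : ∫ x in Ioo a b, glue a b (parabola a b s c) f x = ∫ x in Ioo a b, f x := by
    rw [← hint]
    exact setIntegral_congr_fun measurableSet_Ioo fun x hx => glue_eq_left hx
  have hfr : frontier (Ioo a b) = {a, b} := frontier_Ioo hab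
  have hEI : surfaceEnergyOn (Ioo a b) (glue a b (parabola a b s c) f) =
      surfaceEnergyOn (Ioo a b) (parabola a b s c) := by
    unfold surfaceEnergyOn
    exact setLIntegral_congr_fun measurableSet_Ioo fun x hx => by
      simp only [deriv_glue_of_mem hx]
  refine ⟨glue a b (parabola a b s c) f, ⟨hf.glue hab ((contDiff_parabola a b s c).of_le
    (by simp)) (by simp [parabola, ha]) (by simp [parabola, hb]), ?_, hgi⟩,
    fun x hx => glue_eq_right hx, ?_, ?_, ?_⟩
  · intro x hx
    rw [hfr] at hx
    refine glue_eq_right ?_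
    rcases hx with rfl | rfl <;> simp
  · intro x hx
    rw [glue_eq_left hx, parabola]
    have := mul_nonneg hc0 (mul_nonneg (sub_nonneg.2 hx.1.le) (sub_nonneg.2 hx.2.le))
    linarith
  · unfold surfaceEnergyOn
    refine lintegral_congr_ae ?_
    filter_upwards [ae_restrict_of_ae (ae_mem_Ioo_or_notMem_Icc a b),
      ae_restrict_mem measurableSet_Ioo.compl] with x hx hx'
    rcases hx with hx | hx
    · exact absurd hx hx'
    · rw [deriv_glue_of_notMem hx]
  · intro g hg
    have hga : g a = s := (hg.boundary a (by rw [hfr]; simp)).trans ha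
    have hgb : g b = s := (hg.boundary b (by rw [hfr]; simp)).trans hb
    refine ⟨∫⁻ x in Ioo a b, ‖deriv g x - deriv (parabola a b s c) x‖ₑ ^ 2, ?_, ?_⟩
    · rw [hEI]
      exact surfaceEnergyOn_eq_parabola_add hab hg.memH1 hga hgb (hg.integral_eq.trans hint.symm)
    · have hpc : ContDiff ℝ ∞ (parabola a b s c) := contDiff_parabola a b s c
      have hpd : Continuous (deriv (parabola a b s c)) := hpc.continuous_deriv (by simp)
      have e : ∫⁻ x in Ioo a b, ‖g x - glue a b (parabola a b s c) f x‖ₑ ^ 2 =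
          ∫⁻ x in Ioo a b, ‖g x - parabola a b s c x‖ₑ ^ 2 :=
        setLIntegral_congr_fun measurableSet_Ioo fun x hx => by simp only [glue_eq_left hx]
      rw [e]
      refine lintegral_sq_le_of_integral_eq
        ((measurable_deriv g).sub hpd.measurable).aemeasurable fun x hx => ?_
      rw [intervalIntegral.integral_sub (hg.memH1.intervalIntegrable_deriv a x)
        (hpd.intervalIntegrable _ _), hg.memH1.integral_deriv,
        intervalIntegral.integral_deriv_eq_sub (fun y _ => hpc.differentiable (by simp) y)
        (hpd.intervalIntegrable _ _), hga]
      simp [parabola]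
      ring

/-! ### Superlevel sets and their components -/

/-- Markov's inequality. It bounds both the length of a component and the decay length `Λ` of the
elastic energy. -/
theorem volume_superlevel_le {f : ℝ → ℝ} (h0 : ∀ x, 0 ≤ f x) (hi : Integrable f) {s : ℝ}
    (hs : 0 < s) : volume {x | s < f x} ≤ ENNReal.ofReal ((∫ x, f x) / s) := by
  have h1 : ENNReal.ofReal s * volume {x | ENNReal.ofReal s ≤ ENNReal.ofReal (f x)} ≤
      ∫⁻ x, ENNReal.ofReal (f x) :=
    mul_meas_ge_le_lintegral₀ hi.aemeasurable.ennreal_ofReal _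
  rw [← ofReal_integral_eq_lintegral_ofReal hi (Eventually.of_forall h0)] at h1
  rw [ENNReal.ofReal_div_of_pos hs, ENNReal.le_div_iff_mul_le
    (Or.inl (by simpa using hs)) (Or.inl ENNReal.ofReal_ne_top), mul_comm]
  refine le_trans ?_ h1
  gcongr with x
  intro hx
  exact ENNReal.ofReal_le_ofReal (le_of_lt hx)

/-- A component of a superlevel set of a continuous integrable function is a bounded open
interval, on the ends of which the function takes the value of the level. -/
theorem component_superlevel {f : ℝ → ℝ} (hf : Continuous f) (h0 : ∀ x, 0 ≤ f x)
    (hi : Integrable f) {s : ℝ} (hs : 0 < s) {x : ℝ} (hx : s < f x) :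
    ∃ a b, a < b ∧ connectedComponentIn {y | s < f y} x = Ioo a b ∧ f a = s ∧ f b = s ∧
      b - a ≤ (∫ x, f x) / s := by
  set F := {y | s < f y} with hF
  have hFo : IsOpen F := isOpen_lt continuous_const hf
  set J := connectedComponentIn F x with hJ
  have hJF : J ⊆ F := connectedComponentIn_subset _ _
  have hJo : IsOpen J := hFo.connectedComponentIn
  have hxJ : x ∈ J := mem_connectedComponentIn hx
  have hJc : IsPreconnected J := isPreconnected_connectedComponentIn
  have hvol : volume J ≤ ENNReal.ofReal ((∫ x, f x) / s) :=
    (measure_mono hJF).trans (volume_superlevel_le h0 hi hs)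
  have htop : volume J ≠ ⊤ := (hvol.trans_lt ENNReal.ofReal_lt_top).ne
  have hC : 0 ≤ (∫ x, f x) / s := div_nonneg (integral_nonneg h0) hs.le
  have hlen : ∀ y ∈ J, ∀ z ∈ J, y ≤ z → z - y ≤ (∫ x, f x) / s := by
    intro y hy z hz hyz
    have h1 : Icc y z ⊆ J := hJc.Icc_subset hy hz
    have h2 := (measure_mono h1).trans hvol
    rw [Real.volume_Icc] at h2
    exact (ENNReal.ofReal_le_ofReal_iff hC).1 h2
  have hbb : BddBelow J := by
    refine ⟨x - (∫ x, f x) / s, fun y hy => ?_⟩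
    rcases le_total y x with h | h
    · linarith [hlen y hy x hxJ h]
    · linarith
  have hba : BddAbove J := by
    refine ⟨x + (∫ x, f x) / s, fun y hy => ?_⟩
    rcases le_total y x with h | h
    · linarith
    · linarith [hlen x hxJ y hy h]
  set a := sInf J
  set b := sSup J
  have hane : a ∉ J := by
    intro h
    obtain ⟨ε, hε, hb⟩ := Metric.isOpen_iff.1 hJo a h
    have : a - ε / 2 ∈ J := hb (by
      rw [Metric.mem_ball, Real.dist_eq, abs_lt]; constructor <;> linarith)
    linarith [csInf_le hbb this]
  have hbne : b ∉ J := by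
    intro h
    obtain ⟨ε, hε, hb⟩ := Metric.isOpen_iff.1 hJo b h
    have : b + ε / 2 ∈ J := hb (by
      rw [Metric.mem_ball, Real.dist_eq, abs_lt]; constructor <;> linarith)
    linarith [le_csSup hba this]
  have hJI : J = Ioo a b := by
    ext y
    constructor
    · intro hy
      exact ⟨lt_of_le_of_ne (csInf_le hbb hy) fun h => hane (h ▸ hy),
        lt_of_le_of_ne (le_csSup hba hy) fun h => hbne (h ▸ hy)⟩
    · rintro ⟨h1, h2⟩
      obtain ⟨c, hc, hcy⟩ := exists_lt_of_csInf_lt ⟨x, hxJ⟩ h1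
      obtain ⟨d, hd, hyd⟩ := exists_lt_of_lt_csSup ⟨x, hxJ⟩ h2
      exact hJc.Icc_subset hc hd ⟨hcy.le, hyd.le⟩
  have hxI : x ∈ Ioo a b := hJI ▸ hxJ
  have hab : a < b := hxI.1.trans hxI.2
  have hcl : ∀ y ∈ closure J, s ≤ f y := by
    intro y hy
    have : closure J ⊆ {y | s ≤ f y} :=
      closure_minimal (hJF.trans fun z (hz : s < f z) => show s ≤ f z from hz.le) (isClosed_le continuous_const hf)
    exact this hy
  -- If `f y > s` at an end point `y`, then `insert y J` is a larger connected subset of the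
  -- superlevel set, contradicting the maximality of the component.
  have hend : ∀ y ∈ closure J, y ∉ J → f y = s := by
    intro y hy hyJ
    refine le_antisymm (not_lt.1 fun hlt => hyJ ?_) (hcl y hy)
    have hyF : y ∈ F := hlt
    have h1 : IsPreconnected (insert y J) :=
      hJc.subset_closure (subset_insert _ _) (insert_subset hy subset_closure)
    exact h1.subset_connectedComponentIn (mem_insert_of_mem _ hxJ)
      (insert_subset hyF hJF) (mem_insert _ _)
  have hclJ : closure J = Icc a b := by rw [hJI, closure_Ioo hab.ne]
  refine ⟨a, b, hab, hJI, hend a (hclJ ▸ ⟨le_rfl, hab.le⟩) hane,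
    hend b (hclJ ▸ ⟨hab.le, le_rfl⟩) hbne, ?_⟩
  rw [hJI, Real.volume_Ioo] at hvol
  exact (ENNReal.ofReal_le_ofReal_iff hC).1 hvol

/-! ### Rescaling -/

theorem map_mul_left_volume {B : ℝ} (hB : 0 < B) :
    Measure.map (fun x => B * x) volume = ENNReal.ofReal B⁻¹ • volume := by
  rw [Real.map_volume_mul_left hB.ne', abs_of_pos (inv_pos.2 hB)]

theorem memLp_comp_const_mul {f : ℝ → ℝ} (hf : MemLp f 2 volume) {B : ℝ} (hB : 0 < B) :
    MemLp (fun x => f (B * x)) 2 volume := by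
  have h1 : MemLp f 2 (Measure.map (fun x => B * x) volume) := by
    rw [map_mul_left_volume hB]
    exact hf.smul_measure ENNReal.ofReal_ne_top
  exact h1.comp_of_map (measurable_const_mul B).aemeasurable

theorem lintegral_comp_const_mul (g : ℝ → ℝ≥0∞) {B : ℝ} (hB : 0 < B) :
    ∫⁻ x, g (B * x) = ENNReal.ofReal B⁻¹ * ∫⁻ x, g x := by
  have h := lintegral_map_equiv (μ := volume) g (MeasurableEquiv.mulLeft₀ B hB.ne')
  have e : ⇑(MeasurableEquiv.mulLeft₀ B hB.ne') = fun x => B * x := rfl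
  rw [e, map_mul_left_volume hB, lintegral_smul_measure] at h
  exact h.symm

theorem deriv_scale (f : ℝ → ℝ) (A B x : ℝ) :
    deriv (fun x => A * f (B * x)) x = A * B * deriv f (B * x) := by
  rw [deriv_const_mul_field, deriv_comp_mul_left, smul_eq_mul, mul_assoc]

theorem MemH1Line.scale {f : ℝ → ℝ} (hf : MemH1Line f) (A : ℝ) {B : ℝ} (hB : 0 < B) :
    MemH1Line fun x => A * f (B * x) := by
  have hd : MemLp (fun x => A * B * deriv f (B * x)) 2 volume :=
    (memLp_comp_const_mul hf.memLp_deriv hB).const_mul _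
  refine ⟨(memLp_comp_const_mul hf.memLp hB).const_mul A,
    absolutelyContinuousOnInterval_of_eq_integral (c := 0)
      (q' := fun x => A * B * deriv f (B * x)) (fun a b =>
      ⟨(hd.restrict _).integrable (by norm_num), (hd.restrict _).integrable (by norm_num)⟩)
      fun x => ?_, ?_⟩
  · rw [intervalIntegral.integral_const_mul, intervalIntegral.integral_comp_mul_left _ hB.ne',
      hf.integral_deriv, smul_eq_mul]
    field_simp
    ring
  · exact (memLp_congr_ae (Eventually.of_forall (deriv_scale f A B))).2 hd

theorem surfaceEnergy_scale (f : ℝ → ℝ) (A : ℝ) {B : ℝ} (hB : 0 < B) :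
    surfaceEnergy (fun x => A * f (B * x)) = ENNReal.ofReal (A ^ 2 * B) * surfaceEnergy f := by
  unfold surfaceEnergy surfaceEnergyOn
  simp only [Measure.restrict_univ, deriv_scale, enorm_mul, mul_pow]
  rw [lintegral_const_mul' _ _ (by finiteness),
    lintegral_comp_const_mul (fun y => ‖deriv f y‖ₑ ^ 2) hB, ← mul_assoc]
  congr 1
  rw [← ofReal_norm, ← ofReal_norm, ← ENNReal.ofReal_pow (norm_nonneg _),
    ← ENNReal.ofReal_pow (norm_nonneg _), ← ENNReal.ofReal_mul (by positivity),
    ← ENNReal.ofReal_mul (by positivity)]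
  congr 1
  rw [Real.norm_eq_abs, Real.norm_eq_abs, sq_abs, sq_abs]
  field_simp

theorem integral_scale (f : ℝ → ℝ) (A : ℝ) {B : ℝ} (hB : 0 < B) :
    ∫ x, A * f (B * x) = A * B⁻¹ * ∫ x, f x := by
  rw [integral_const_mul, Measure.integral_comp_mul_left, abs_of_pos (inv_pos.2 hB),
    smul_eq_mul, mul_assoc]

theorem integrable_scale {f : ℝ → ℝ} (hf : Integrable f) (A : ℝ) {B : ℝ} (hB : 0 < B) :
    Integrable fun x => A * f (B * x) :=
  ((integrable_comp_mul_left_iff f hB.ne').2 hf).const_mul A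

/-- Sobolev functions on the line are bounded, as soon as they are nonnegative and integrable. -/
theorem MemH1Line.exists_le {f : ℝ → ℝ} (hf : MemH1Line f) (h0 : ∀ x, 0 ≤ f x)
    (hi : Integrable f) : ∃ M, ∀ x, f x ≤ M := by
  set N := (surfaceEnergy f).toReal with hN
  refine ⟨(∫ x, f x) + √N, fun x => ?_⟩
  -- Cauchy–Schwarz on an interval of length at most one. Averaging over `y` then compares `f x`
  -- with the total integral.
  have osc : ∀ y ∈ Ioc (x - 1) x, f x - f y ≤ √N := by
    intro y hy
    refine Real.le_sqrt_of_sq_le ?_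
    have h1 : ‖f x - f y‖ₑ ≤ ∫⁻ z in Ioc y x, ‖deriv f z‖ₑ := by
      rw [← hf.integral_deriv, intervalIntegral.integral_of_le hy.2]
      exact enorm_integral_le_lintegral_enorm _
    have h2 := (pow_le_pow_left' h1 2).trans (sq_lintegral_le_measure_mul _
      (measurable_deriv f).enorm.aemeasurable)
    have h3 : ‖f x - f y‖ₑ ^ 2 ≤ surfaceEnergy f := by
      refine h2.trans ?_
      rw [Measure.restrict_apply_univ, Real.volume_Ioc]
      calc ENNReal.ofReal (x - y) * ∫⁻ z in Ioc y x, ‖deriv f z‖ₑ ^ 2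
          ≤ 1 * ∫⁻ z in univ, ‖deriv f z‖ₑ ^ 2 := by
            gcongr
            · exact ENNReal.ofReal_le_one.2 (by linarith [hy.1])
            · exact subset_univ _
        _ = surfaceEnergy f := one_mul _
    rw [← ofReal_norm, ← ENNReal.ofReal_pow (norm_nonneg _), Real.norm_eq_abs, sq_abs] at h3
    exact (ENNReal.ofReal_le_iff_le_toReal (surfaceEnergy_ne_top hf)).1 h3
  have h4 : ∫ y in Ioc (x - 1) x, (f x - √N) ≤ ∫ y in Ioc (x - 1) x, f y :=
    setIntegral_mono_on (integrable_const _) hi.integrableOn measurableSet_Ioc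
      fun y hy => by linarith [osc y hy]
  have h5 : ∫ y in Ioc (x - 1) x, f y ≤ ∫ y, f y :=
    setIntegral_le_integral hi (Eventually.of_forall h0)
  simp at h4
  linarith

/-! ### Sobolev functions in the plane -/

/-- `(G₁, G₂)` is the weak gradient of `U` on `Ω`, where all the functions are measurable,
square integrable, and extended by zero to the plane. -/
structure PlaneSobolev (Ω : Set (ℝ × ℝ)) (U G₁ G₂ : ℝ × ℝ → ℝ) : Prop where
  meas : Measurable U
  meas_fst : Measurable G₁
  meas_snd : Measurable G₂
  memLp : MemLp U 2 volume
  memLp_fst : MemLp G₁ 2 volume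
  memLp_snd : MemLp G₂ 2 volume
  zero_fst : ∀ z ∉ Ω, G₁ z = 0
  zero_snd : ∀ z ∉ Ω, G₂ z = 0
  integral_fst : ∀ φ : ℝ × ℝ → ℝ, ContDiff ℝ ∞ φ → HasCompactSupport φ → tsupport φ ⊆ Ω →
    ∫ z, (U z * fderiv ℝ φ z (1, 0) + G₁ z * φ z) = 0
  integral_snd : ∀ φ : ℝ × ℝ → ℝ, ContDiff ℝ ∞ φ → HasCompactSupport φ → tsupport φ ⊆ Ω →
    ∫ z, (U z * fderiv ℝ φ z (0, 1) + G₂ z * φ z) = 0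

theorem fderiv_eq_zero_of_notMem_tsupport {E : Type*} [NormedAddCommGroup E] [NormedSpace ℝ E]
    {φ : E → ℝ} {z : E} (hz : z ∉ tsupport φ) : fderiv ℝ φ z = 0 := by
  by_contra h
  exact hz (support_fderiv_subset ℝ h)

theorem integrable_mul_test {Ω : Set (ℝ × ℝ)} {F φ : ℝ × ℝ → ℝ}
    (hF : MemLp F 2 (volume.restrict Ω)) (hφ : Continuous φ) (hc : HasCompactSupport φ) :
    IntegrableOn (fun z => F z * φ z) Ω :=
  hF.integrable_mul (q := 2) (hφ.memLp_of_hasCompactSupport hc)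

theorem integrable_mul_fderiv {Ω : Set (ℝ × ℝ)} {F φ : ℝ × ℝ → ℝ}
    (hF : MemLp F 2 (volume.restrict Ω)) (hφ : ContDiff ℝ ∞ φ) (hc : HasCompactSupport φ)
    (v : ℝ × ℝ) : IntegrableOn (fun z => F z * fderiv ℝ φ z v) Ω :=
  integrable_mul_test hF ((hφ.continuous_fderiv (by simp)).clm_apply continuous_const)
    (hc.fderiv_apply (𝕜 := ℝ) v)

theorem exists_measurable_extension {Ω : Set (ℝ × ℝ)} (hΩ : MeasurableSet Ω) {F : ℝ × ℝ → ℝ}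
    (hF : MemLp F 2 (volume.restrict Ω)) :
    ∃ G : ℝ × ℝ → ℝ, Measurable G ∧ MemLp G 2 volume ∧ (∀ z ∉ Ω, G z = 0) ∧
      F =ᵐ[volume.restrict Ω] G := by
  have hm := hF.aestronglyMeasurable
  refine ⟨Ω.indicator (hm.mk F), hm.stronglyMeasurable_mk.measurable.indicator hΩ, ?_,
    fun z hz => indicator_of_notMem hz _, ?_⟩
  · rw [memLp_indicator_iff_restrict hΩ]
    exact (memLp_congr_ae hm.ae_eq_mk).1 hF
  · filter_upwards [hm.ae_eq_mk, ae_restrict_mem hΩ] with z hz hzΩ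
    rw [hz, indicator_of_mem hzΩ]

/-- Restricting to lines requires measurable functions defined on the whole plane, whereas `u` and
its gradient are given only up to null sets of `Ω`. -/
theorem IsWeakGradient.exists_planeSobolev {Ω : Set (ℝ × ℝ)} (hΩ : MeasurableSet Ω)
    {u : ℝ × ℝ → ℝ} {g : ℝ × ℝ → ℝ × ℝ} (hu : MemLp u 2 (volume.restrict Ω))
    (hg : IsWeakGradient Ω u g) :
    ∃ U G₁ G₂ : ℝ × ℝ → ℝ, PlaneSobolev Ω U G₁ G₂ ∧ u =ᵐ[volume.restrict Ω] U ∧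
      (fun z => (g z).1) =ᵐ[volume.restrict Ω] G₁ ∧
      (fun z => (g z).2) =ᵐ[volume.restrict Ω] G₂ := by
  obtain ⟨U, hUm, hU2, hU0, hU⟩ := exists_measurable_extension hΩ hu
  obtain ⟨G₁, h1m, h12, h10, h1⟩ := exists_measurable_extension hΩ hg.memLp_fst
  obtain ⟨G₂, h2m, h22, h20, h2⟩ := exists_measurable_extension hΩ hg.memLp_snd
  have key : ∀ (G γ : ℝ × ℝ → ℝ) (v : ℝ × ℝ), MemLp γ 2 (volume.restrict Ω) →
      γ =ᵐ[volume.restrict Ω] G → (∀ z ∉ Ω, G z = 0) → ∀ φ : ℝ × ℝ → ℝ, ContDiff ℝ ∞ φ →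
      HasCompactSupport φ → ∫ z in Ω, u z * fderiv ℝ φ z v = -∫ z in Ω, γ z * φ z →
      ∫ z, (U z * fderiv ℝ φ z v + G z * φ z) = 0 := by
    intro G γ v hγ hG hG0 φ hφ hc h
    rw [← setIntegral_eq_integral_of_forall_compl_eq_zero (s := Ω)
      fun z hz => by rw [hU0 z hz, hG0 z hz]; ring]
    have e : (fun z => U z * fderiv ℝ φ z v + G z * φ z) =ᵐ[volume.restrict Ω]
        fun z => u z * fderiv ℝ φ z v + γ z * φ z := by
      filter_upwards [hU, hG] with z hz hz'
      rw [hz, hz']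
    rw [integral_congr_ae e, integral_add (integrable_mul_fderiv hu hφ hc v)
      (integrable_mul_test hγ hφ.continuous hc), h, neg_add_cancel]
  exact ⟨U, G₁, G₂, ⟨hUm, h1m, h2m, hU2, h12, h22, h10, h20,
    fun φ hφ hc hs => key G₁ _ _ hg.memLp_fst h1 h10 φ hφ hc (hg.integral_fst φ hφ hc hs),
    fun φ hφ hc hs => key G₂ _ _ hg.memLp_snd h2 h20 φ hφ hc (hg.integral_snd φ hφ hc hs)⟩,
    hU, h1, h2⟩

theorem PlaneSobolev.isWeakGradient {Ω : Set (ℝ × ℝ)} {u U G₁ G₂ : ℝ × ℝ → ℝ}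
    (h : PlaneSobolev Ω U G₁ G₂) (hu : u =ᵐ[volume.restrict Ω] U) :
    IsWeakGradient Ω u fun z => (G₁ z, G₂ z) := by
  have key : ∀ (G φ : ℝ × ℝ → ℝ) (v : ℝ × ℝ), MemLp G 2 volume → ContDiff ℝ ∞ φ →
      HasCompactSupport φ → tsupport φ ⊆ Ω → ∫ z, (U z * fderiv ℝ φ z v + G z * φ z) = 0 →
      ∫ z in Ω, u z * fderiv ℝ φ z v = -∫ z in Ω, G z * φ z := by
    intro G φ v hG hφ hc hs h0
    have i1 := integrable_mul_fderiv (h.memLp.restrict Ω) hφ hc v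
    have i2 := integrable_mul_test (hG.restrict Ω) hφ.continuous hc
    have e : (fun z => u z * fderiv ℝ φ z v) =ᵐ[volume.restrict Ω]
        fun z => U z * fderiv ℝ φ z v := by
      filter_upwards [hu] with z hz
      rw [hz]
    rw [integral_congr_ae e, eq_neg_iff_add_eq_zero, ← integral_add i1 i2,
      setIntegral_eq_integral_of_forall_compl_eq_zero, h0]
    intro z hz
    have hz' : z ∉ tsupport φ := fun h => hz (hs h)
    rw [fderiv_eq_zero_of_notMem_tsupport hz', image_eq_zero_of_notMem_tsupport hz']
    simp
  exact ⟨h.memLp_fst.restrict Ω, h.memLp_snd.restrict Ω,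
    fun φ hφ hc hs => key G₁ φ _ h.memLp_fst hφ hc hs (h.integral_fst φ hφ hc hs),
    fun φ hφ hc hs => key G₂ φ _ h.memLp_snd hφ hc hs (h.integral_snd φ hφ hc hs)⟩

theorem ae_eq_of_integral_test_eq {Ω : Set (ℝ × ℝ)} (hΩ : IsOpen Ω) {F G : ℝ × ℝ → ℝ}
    (hF : MemLp F 2 (volume.restrict Ω)) (hG : MemLp G 2 (volume.restrict Ω))
    (h : ∀ φ : ℝ × ℝ → ℝ, ContDiff ℝ ∞ φ → HasCompactSupport φ → tsupport φ ⊆ Ω →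
      ∫ z in Ω, F z * φ z = ∫ z in Ω, G z * φ z) : F =ᵐ[volume.restrict Ω] G := by
  have hl : LocallyIntegrableOn (fun z => F z - G z) Ω :=
    locallyIntegrableOn_of_locallyIntegrable_restrict ((hF.sub hG).locallyIntegrable (by norm_num))
  have h0 := hΩ.ae_eq_zero_of_integral_contDiff_smul_eq_zero hl fun φ hφ hc hs => by
    rw [← setIntegral_eq_integral_of_forall_compl_eq_zero (s := Ω)]
    · have e : ∀ z, φ z • (F z - G z) = F z * φ z - G z * φ z := fun z => by
        rw [smul_eq_mul]; ring
      simp only [e]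
      rw [integral_sub (integrable_mul_test hF hφ.continuous hc)
        (integrable_mul_test hG hφ.continuous hc), h φ hφ hc hs, sub_self]
    · intro z hz
      rw [image_eq_zero_of_notMem_tsupport fun h => hz (hs h), zero_smul]
  rw [EventuallyEq, ae_restrict_iff' hΩ.measurableSet]
  filter_upwards [h0] with z hz hzΩ using sub_eq_zero.1 (hz hzΩ)

theorem dirichletEnergy_eq {Ω : Set (ℝ × ℝ)} (hΩ : IsOpen Ω) {u : ℝ × ℝ → ℝ}
    {g : ℝ × ℝ → ℝ × ℝ} (hg : IsWeakGradient Ω u g) :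
    dirichletEnergy Ω u = ∫⁻ z in Ω, ENNReal.ofReal ((g z).1 ^ 2 + (g z).2 ^ 2) := by
  refine le_antisymm (iInf₂_le g hg) (le_iInf₂ fun g' hg' => le_of_eq ?_)
  have h1 := ae_eq_of_integral_test_eq hΩ hg.memLp_fst hg'.memLp_fst fun φ hφ hc hs =>
    neg_injective ((hg.integral_fst φ hφ hc hs).symm.trans (hg'.integral_fst φ hφ hc hs))
  have h2 := ae_eq_of_integral_test_eq hΩ hg.memLp_snd hg'.memLp_snd fun φ hφ hc hs =>
    neg_injective ((hg.integral_snd φ hφ hc hs).symm.trans (hg'.integral_snd φ hφ hc hs))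
  refine lintegral_congr_ae ?_
  filter_upwards [h1, h2] with z hz1 hz2
  rw [hz1, hz2]

theorem isOpen_filmDomain {h : ℝ → ℝ} (hh : Continuous h) : IsOpen (filmDomain h) :=
  (isOpen_lt continuous_const continuous_snd).inter
    (isOpen_lt continuous_snd (hh.comp continuous_fst))

/-! ### Restriction to horizontal lines -/

/-- Supplies the vertical factor in `PlaneSobolev.slice_snd`. It need not be compactly supported,
being multiplied by a test function there. -/
theorem contDiff_integral_Ioi {ψ : ℝ → ℝ} (hψ : ContDiff ℝ ∞ ψ)
    (hc : HasCompactSupport ψ) :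
    ContDiff ℝ ∞ (fun y => ∫ t in Ioi y, ψ t) ∧
      ∀ y, HasDerivAt (fun y => ∫ t in Ioi y, ψ t) (-ψ y) y := by
  have hi : Integrable ψ := hψ.continuous.integrable_of_hasCompactSupport hc
  have e : (fun y => ∫ t in Ioi y, ψ t) = fun y => (∫ t in Ioi 0, ψ t) - ∫ t in (0 : ℝ)..y, ψ t := by
    funext y
    rw [← intervalIntegral.integral_interval_add_Ioi (a := 0) (b := y) hi.integrableOn
      hi.integrableOn]
    ring
  have hd : ∀ y, HasDerivAt (fun y => ∫ t in Ioi y, ψ t) (-ψ y) y := by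
    intro y
    rw [e]
    exact (intervalIntegral.integral_hasDerivAt_right (hψ.continuous.intervalIntegrable _ _)
      hψ.continuous.aestronglyMeasurable.stronglyMeasurableAtFilter
      hψ.continuous.continuousAt).const_sub _
  refine ⟨?_, hd⟩
  rw [contDiff_infty_iff_deriv]
  refine ⟨fun y => (hd y).differentiableAt, ?_⟩
  rw [show deriv (fun y => ∫ t in Ioi y, ψ t) = fun y => -ψ y from funext fun y => (hd y).deriv]
  exact hψ.neg

theorem fderiv_mul_comp_snd {φ : ℝ × ℝ → ℝ} {ψ : ℝ → ℝ} {ψ' : ℝ} {z : ℝ × ℝ}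
    (hφ : DifferentiableAt ℝ φ z) (hψ : HasDerivAt ψ ψ' z.2) (v : ℝ × ℝ) :
    fderiv ℝ (fun z : ℝ × ℝ => φ z * ψ z.2) z v = fderiv ℝ φ z v * ψ z.2 + φ z * (ψ' * v.2) := by
  have h1 : HasFDerivAt (fun z : ℝ × ℝ => ψ z.2) (ψ' • ContinuousLinearMap.snd ℝ ℝ ℝ) z :=
    HasDerivAt.comp_hasFDerivAt z hψ hasFDerivAt_snd
  have h2 := (hφ.hasFDerivAt.mul h1).fderiv
  rw [show (fun z : ℝ × ℝ => φ z * ψ z.2) = φ * fun z => ψ z.2 from rfl, h2]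
  simp
  ring

theorem tsupport_mul_comp_snd_subset (φ : ℝ × ℝ → ℝ) (ψ : ℝ → ℝ) :
    tsupport (fun z : ℝ × ℝ => φ z * ψ z.2) ⊆ tsupport φ :=
  closure_mono fun z hz h => hz (by simp [h])

/-- Multiplication by `ψ(y)` commutes with `∂ₓ` and keeps `φ` a test function. By Fubini the slice
integral is thus orthogonal to every `ψ`, hence zero almost everywhere. -/
theorem PlaneSobolev.slice_fst {Ω : Set (ℝ × ℝ)} {U G₁ G₂ : ℝ × ℝ → ℝ}
    (h : PlaneSobolev Ω U G₁ G₂) {φ : ℝ × ℝ → ℝ} (hφ : ContDiff ℝ ∞ φ)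
    (hc : HasCompactSupport φ) (hs : tsupport φ ⊆ Ω) :
    ∀ᵐ t : ℝ, ∫ x : ℝ, (U (x, t) * fderiv ℝ φ (x, t) (1, 0) + G₁ (x, t) * φ (x, t)) = 0 := by
  have hi : Integrable (fun z => U z * fderiv ℝ φ z (1, 0) + G₁ z * φ z) (volume : Measure (ℝ × ℝ)) := by
    have i1 := integrable_mul_fderiv (Ω := univ) (by simpa using h.memLp) hφ hc (1, 0)
    have i2 := integrable_mul_test (Ω := univ) (by simpa using h.memLp_fst) hφ.continuous hc
    rw [integrableOn_univ] at i1 i2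
    exact i1.add i2
  have hi' := hi
  rw [Measure.volume_eq_prod] at hi'
  refine ae_eq_zero_of_integral_contDiff_smul_eq_zero hi'.integral_prod_right.locallyIntegrable
    fun ψ hψ hψc => ?_
  have hψ2 : ContDiff ℝ ∞ (fun z : ℝ × ℝ => φ z * ψ z.2) := hφ.mul (hψ.comp contDiff_snd)
  have h0 := h.integral_fst _ hψ2 hc.mul_right ((tsupport_mul_comp_snd_subset φ ψ).trans hs)
  have e : ∀ z, U z * fderiv ℝ (fun z : ℝ × ℝ => φ z * ψ z.2) z (1, 0) + G₁ z * (φ z * ψ z.2) =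
      ψ z.2 • (U z * fderiv ℝ φ z (1, 0) + G₁ z * φ z) := by
    intro z
    rw [fderiv_mul_comp_snd (hφ.differentiable (by simp) z)
      (hψ.differentiable (by simp) z.2).hasDerivAt, smul_eq_mul]
    simp
    ring
  have hi2 : Integrable (fun z : ℝ × ℝ => ψ z.2 • (U z * fderiv ℝ φ z (1, 0) + G₁ z * φ z))
      (volume : Measure (ℝ × ℝ)) := by
    have i1 := integrable_mul_fderiv (Ω := univ) (by simpa using h.memLp) hψ2 hc.mul_right (1, 0)
    have i2 := integrable_mul_test (Ω := univ) (by simpa using h.memLp_fst) hψ2.continuous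
      hc.mul_right
    rw [integrableOn_univ] at i1 i2
    exact (i1.add i2).congr (Eventually.of_forall e)
  rw [Measure.volume_eq_prod] at hi2 h0
  simp only [e] at h0
  rw [integral_prod_symm _ hi2] at h0
  simpa only [integral_smul] using h0

/-- Green's formula on `{y < t}`, obtained by testing with `φ Ψ`, where `Ψ(y) = ∫_y^∞ ψ`. Writing
`Ψ(y)` as the integral of `ψ(t)` over `t > y` and exchanging integrals produces the half-plane
integrals, and `Ψ' = -ψ` produces the boundary term. -/
theorem PlaneSobolev.slice_snd {Ω : Set (ℝ × ℝ)} {U G₁ G₂ : ℝ × ℝ → ℝ}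
    (h : PlaneSobolev Ω U G₁ G₂) {φ : ℝ × ℝ → ℝ} (hφ : ContDiff ℝ ∞ φ)
    (hc : HasCompactSupport φ) (hs : tsupport φ ⊆ Ω) :
    ∀ᵐ t : ℝ, (∫ z in {z : ℝ × ℝ | z.2 < t}, (U z * fderiv ℝ φ z (0, 1) + G₂ z * φ z)) -
      ∫ x : ℝ, U (x, t) * φ (x, t) = 0 := by
  set K : ℝ × ℝ → ℝ := fun z => U z * fderiv ℝ φ z (0, 1) + G₂ z * φ z with hK
  have hUφ : Integrable (fun z => U z * φ z) (volume : Measure (ℝ × ℝ)) := by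
    have := integrable_mul_test (Ω := univ) (by simpa using h.memLp) hφ.continuous hc
    rwa [integrableOn_univ] at this
  have hKi : Integrable K (volume : Measure (ℝ × ℝ)) := by
    have i1 := integrable_mul_fderiv (Ω := univ) (by simpa using h.memLp) hφ hc (0, 1)
    have i2 := integrable_mul_test (Ω := univ) (by simpa using h.memLp_snd) hφ.continuous hc
    rw [integrableOn_univ] at i1 i2
    exact i1.add i2
  have hKm : Measurable K := (h.meas.mul
    ((hφ.continuous_fderiv (by simp)).clm_apply continuous_const).measurable).add
    (h.meas_snd.mul hφ.continuous.measurable)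
  have hUφ' := hUφ
  rw [Measure.volume_eq_prod] at hUφ'
  have hSt : MeasurableSet {q : ℝ × (ℝ × ℝ) | q.2.2 < q.1} :=
    measurableSet_lt (measurable_snd.comp measurable_snd) measurable_fst
  set W : ℝ → ℝ × ℝ → ℝ := fun t z => {q : ℝ × (ℝ × ℝ) | q.2.2 < q.1}.indicator
    (fun q => K q.2) (t, z) with hW
  have hWeq : ∀ t, ∫ z in {z : ℝ × ℝ | z.2 < t}, K z = ∫ z, W t z := by
    intro t
    rw [← integral_indicator (measurableSet_lt measurable_snd measurable_const)]
    rfl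
  have hWle : ∀ t z, ‖W t z‖ ≤ ‖K z‖ := fun t z =>
    norm_indicator_le_norm_self (fun q : ℝ × (ℝ × ℝ) => K q.2) (t, z)
  have hWm : Measurable (Function.uncurry W) := (hKm.comp measurable_snd).indicator hSt
  have hWloc : LocallyIntegrable (fun t => ∫ z, W t z) volume := by
    refine (locallyIntegrable_const (∫ z, ‖K z‖)).mono
      hWm.stronglyMeasurable.integral_prod_right.aestronglyMeasurable
      (Eventually.of_forall fun t => ?_)
    rw [Real.norm_of_nonneg (integral_nonneg fun z => norm_nonneg (K z))]
    exact norm_integral_le_of_norm_le hKi.norm (Eventually.of_forall (hWle t))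
  simp only [hWeq]
  refine ae_eq_zero_of_integral_contDiff_smul_eq_zero
    (hWloc.sub hUφ'.integral_prod_right.locallyIntegrable) fun ψ hψ hψc => ?_
  obtain ⟨hΨ, hΨd⟩ := contDiff_integral_Ioi hψ hψc
  set Ψ : ℝ → ℝ := fun y => ∫ t in Ioi y, ψ t with hΨdef
  have hψi : Integrable ψ := hψ.continuous.integrable_of_hasCompactSupport hψc
  have hΨ2 : ContDiff ℝ ∞ (fun z : ℝ × ℝ => φ z * Ψ z.2) := hφ.mul (hΨ.comp contDiff_snd)
  have h0 := h.integral_snd _ hΨ2 hc.mul_right ((tsupport_mul_comp_snd_subset φ Ψ).trans hs)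
  have e : ∀ z, U z * fderiv ℝ (fun z : ℝ × ℝ => φ z * Ψ z.2) z (0, 1) + G₂ z * (φ z * Ψ z.2) =
      K z * Ψ z.2 - ψ z.2 * (U z * φ z) := by
    intro z
    rw [fderiv_mul_comp_snd (hφ.differentiable (by simp) z) (hΨd z.2), hK]
    ring
  simp only [e] at h0
  have hbig : Integrable (Function.uncurry fun t z => ψ t * W t z)
      ((volume : Measure ℝ).prod (volume : Measure (ℝ × ℝ))) := by
    refine (hψi.mul_prod hKi).mono ((hψ.continuous.measurable.comp measurable_fst).mul
      hWm).aestronglyMeasurable (Eventually.of_forall fun q => ?_)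
    rw [Function.uncurry, norm_mul, norm_mul]
    exact mul_le_mul_of_nonneg_left (hWle _ _) (norm_nonneg _)
  have hψW : ∀ z t, ψ t * W t z = (Ioi z.2).indicator (fun t => K z * ψ t) t := by
    intro z t
    by_cases ht : z.2 < t
    · rw [indicator_of_mem (show t ∈ Ioi z.2 from ht), hW]
      simp only
      rw [indicator_of_mem (show (t, z) ∈ {q : ℝ × (ℝ × ℝ) | q.2.2 < q.1} from ht), mul_comm]
    · rw [indicator_of_notMem (show t ∉ Ioi z.2 from ht), hW]
      simp only
      rw [indicator_of_notMem (show (t, z) ∉ {q : ℝ × (ℝ × ℝ) | q.2.2 < q.1} from ht), mul_zero]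
  have swap : ∫ t, ψ t * ∫ z, W t z = ∫ z, K z * Ψ z.2 := by
    simp only [← integral_const_mul]
    rw [integral_integral_swap hbig]
    refine integral_congr_ae (Eventually.of_forall fun z => ?_)
    simp only [hψW]
    rw [integral_indicator measurableSet_Ioi, integral_const_mul]
  have hI2 : Integrable (fun z : ℝ × ℝ => ψ z.2 * (U z * φ z)) (volume : Measure (ℝ × ℝ)) := by
    have hψ2 : ContDiff ℝ ∞ (fun z : ℝ × ℝ => φ z * ψ z.2) := hφ.mul (hψ.comp contDiff_snd)
    have i1 := integrable_mul_test (Ω := univ) (by simpa using h.memLp) hψ2.continuous hc.mul_right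
    rw [integrableOn_univ] at i1
    exact i1.congr (Eventually.of_forall fun z => by ring)
  have hI1 : Integrable (fun z : ℝ × ℝ => K z * Ψ z.2) (volume : Measure (ℝ × ℝ)) := by
    have := hbig.integral_prod_right
    refine this.congr (Eventually.of_forall fun z => ?_)
    simp only [Function.uncurry, hψW]
    rw [integral_indicator measurableSet_Ioi, integral_const_mul]
  rw [integral_sub hI1 hI2] at h0
  have hI2' := hI2
  rw [Measure.volume_eq_prod] at hI2'
  have e2 : ∫ z : ℝ × ℝ, ψ z.2 * (U z * φ z) = ∫ t, ψ t * ∫ x, U (x, t) * φ (x, t) := by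
    rw [Measure.volume_eq_prod, integral_prod_symm _ hI2']
    simp only [integral_const_mul]
  have e3 : ∀ t, ψ t • ((∫ z, W t z) - ∫ x, U (x, t) * φ (x, t)) =
      ψ t * (∫ z, W t z) - ψ t * ∫ x, U (x, t) * φ (x, t) := fun t => by
    rw [smul_eq_mul, mul_sub]
  simp only [e3]
  rw [integral_sub, swap, ← e2, h0]
  · simpa only [Function.uncurry, integral_const_mul] using hbig.integral_prod_left
  · simpa only [integral_const_mul] using hI2'.integral_prod_right

/-- The test functions supported in a compact set `K` are separable for the `C¹` topology. -/
theorem exists_countable_dense_test {K : Set (ℝ × ℝ)} (hK : IsCompact K) :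
    ∃ S : Set (ℝ × ℝ → ℝ), S.Countable ∧ (∀ φ ∈ S, ContDiff ℝ ∞ φ ∧ tsupport φ ⊆ K) ∧
      ∀ φ : ℝ × ℝ → ℝ, ContDiff ℝ ∞ φ → tsupport φ ⊆ K →
        ∃ (f : ℕ → ℝ × ℝ → ℝ) (C : ℝ), (∀ n, f n ∈ S) ∧
          (∀ n z, ‖f n z‖ ≤ C ∧ ‖fderiv ℝ (f n) z‖ ≤ C) ∧
          ∀ z, Tendsto (fun n => f n z) atTop (𝓝 (φ z)) ∧
            Tendsto (fun n => fderiv ℝ (f n) z) atTop (𝓝 (fderiv ℝ φ z)) := by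
  let T := {φ : ℝ × ℝ → ℝ // ContDiff ℝ ∞ φ ∧ tsupport φ ⊆ K}
  -- Recording `φ` with its derivative embeds the test functions in a product of second countable
  -- spaces (compact-open topology), so the range is separable.
  let J : T → C(ℝ × ℝ, ℝ) × C(ℝ × ℝ, ℝ × ℝ →L[ℝ] ℝ) := fun φ =>
    (⟨φ.1, φ.2.1.continuous⟩, ⟨fderiv ℝ φ.1, φ.2.1.continuous_fderiv (by simp)⟩)
  obtain ⟨D, hDc, hDd⟩ := TopologicalSpace.exists_countable_dense (range J)
  refine ⟨(fun d => (rangeSplitting J d).1) '' D, hDc.image _, ?_, ?_⟩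
  · rintro _ ⟨d, _, rfl⟩
    exact (rangeSplitting J d).2
  · intro φ hφ hφK
    obtain ⟨x, hxD, hx⟩ := mem_closure_iff_seq_limit.1 (hDd ⟨J ⟨φ, hφ, hφK⟩, mem_range_self _⟩)
    set g : ℕ → T := fun n => rangeSplitting J (x n) with hg
    have hJg : ∀ n, J (g n) = (x n).1 := fun n => apply_rangeSplitting J (x n)
    have hlim : Tendsto (fun n => J (g n)) atTop (𝓝 (J ⟨φ, hφ, hφK⟩)) := by
      simp only [hJg]
      exact (continuous_subtype_val.tendsto _).comp hx
    have l1 : Tendsto (fun n => (J (g n)).1) atTop (𝓝 (J ⟨φ, hφ, hφK⟩).1) :=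
      (continuous_fst.tendsto _).comp hlim
    have l2 : Tendsto (fun n => (J (g n)).2) atTop (𝓝 (J ⟨φ, hφ, hφK⟩).2) :=
      (continuous_snd.tendsto _).comp hlim
    have u1 := Metric.tendstoUniformlyOn_iff.1
      (ContinuousMap.tendsto_iff_forall_isCompact_tendstoUniformlyOn.1 l1 K hK) 1 one_pos
    have u2 := Metric.tendstoUniformlyOn_iff.1
      (ContinuousMap.tendsto_iff_forall_isCompact_tendstoUniformlyOn.1 l2 K hK) 1 one_pos
    -- Uniform convergence on `K` puts all terms after the first `N` within distance one of the
    -- limit. Dropping those `N` terms yields the common bound; off `K` everything vanishes.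
    obtain ⟨N, hN⟩ := eventually_atTop.1 (u1.and u2)
    obtain ⟨C₁, hC₁⟩ := hK.exists_bound_of_continuousOn hφ.continuous.continuousOn
    obtain ⟨C₂, hC₂⟩ := hK.exists_bound_of_continuousOn
      (hφ.continuous_fderiv (by simp)).continuousOn
    refine ⟨fun n => (g (n + N)).1, max 0 (max (C₁ + 1) (C₂ + 1)),
      fun n => ⟨x (n + N), hxD _, rfl⟩, fun n z => ?_, fun z => ⟨?_, ?_⟩⟩
    · by_cases hz : z ∈ K
      · obtain ⟨h1, h2⟩ := hN (n + N) (Nat.le_add_left _ _)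
        have h1 : dist (φ z) ((g (n + N)).1 z) < 1 := h1 z hz
        have h2 : dist (fderiv ℝ φ z) (fderiv ℝ (g (n + N)).1 z) < 1 := h2 z hz
        rw [dist_comm, dist_eq_norm] at h1 h2
        constructor
        · refine le_max_of_le_right (le_max_of_le_left ?_)
          linarith [norm_le_norm_add_norm_sub' ((g (n + N)).1 z) (φ z), hC₁ z hz]
        · refine le_max_of_le_right (le_max_of_le_right ?_)
          linarith [norm_le_norm_add_norm_sub' (fderiv ℝ (g (n + N)).1 z) (fderiv ℝ φ z), hC₂ z hz]
      · have hz' : z ∉ tsupport (g (n + N)).1 := fun h => hz ((g (n + N)).2.2 h)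
        simp only [fderiv_eq_zero_of_notMem_tsupport hz', image_eq_zero_of_notMem_tsupport hz']
        simp
    · exact (((continuous_eval_const z).tendsto _).comp l1).comp
        (tendsto_add_atTop_nat N)
    · exact (((continuous_eval_const z).tendsto _).comp l2).comp
        (tendsto_add_atTop_nat N)

theorem exists_compact_exhaustion {Ω : Set (ℝ × ℝ)} (hΩ : IsOpen Ω) :
    ∃ K : ℕ → Set (ℝ × ℝ), (∀ n, IsCompact (K n) ∧ K n ⊆ Ω) ∧
      ∀ C, IsCompact C → C ⊆ Ω → ∃ n, C ⊆ K n := by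
  have : LocallyCompactSpace Ω := hΩ.locallyCompactSpace
  let E : CompactExhaustion Ω := default
  refine ⟨fun n => (↑) '' E n, fun n => ⟨(E.isCompact n).image continuous_subtype_val,
    Subtype.coe_image_subset _ _⟩, fun C hC hCΩ => ?_⟩
  have h1 : IsCompact ((↑) ⁻¹' C : Set Ω) :=
    Topology.IsInducing.subtypeVal.isCompact_preimage' hC (by simpa using hCΩ)
  obtain ⟨n, hn⟩ := E.exists_superset_of_isCompact h1
  exact ⟨n, fun z hz => ⟨⟨z, hCΩ hz⟩, hn hz, rfl⟩⟩

/-- Dominated convergence. The map `ι` lets one statement serve for a line, with `ι x = (x, t)`, and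
for a half-plane, with `ι = id`. -/
theorem tendsto_integral_test {α : Type*} [MeasurableSpace α] {μ : Measure α} {ι : α → ℝ × ℝ}
    (hι : Measurable ι) {K : Set (ℝ × ℝ)} {A B : ℝ × ℝ → ℝ} (hA : Measurable A)
    (hB : Measurable B)
    (hAi : Integrable (fun x => K.indicator (fun z => ‖A z‖ + ‖B z‖) (ι x)) μ) (v : ℝ × ℝ)
    {f : ℕ → ℝ × ℝ → ℝ} {φ : ℝ × ℝ → ℝ} {C : ℝ}
    (hf : ∀ n, ContDiff ℝ ∞ (f n) ∧ tsupport (f n) ⊆ K)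
    (hC : ∀ n z, ‖f n z‖ ≤ C ∧ ‖fderiv ℝ (f n) z‖ ≤ C)
    (hl : ∀ z, Tendsto (fun n => f n z) atTop (𝓝 (φ z)) ∧
      Tendsto (fun n => fderiv ℝ (f n) z) atTop (𝓝 (fderiv ℝ φ z))) :
    Tendsto (fun n => ∫ x, (A (ι x) * fderiv ℝ (f n) (ι x) v + B (ι x) * f n (ι x)) ∂μ) atTop
      (𝓝 (∫ x, (A (ι x) * fderiv ℝ φ (ι x) v + B (ι x) * φ (ι x)) ∂μ)) := by
  have hC0 : 0 ≤ C := (norm_nonneg _).trans (hC 0 0).1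
  refine tendsto_integral_of_dominated_convergence
    (fun x => C * (‖v‖ + 1) * K.indicator (fun z => ‖A z‖ + ‖B z‖) (ι x)) (fun n => ?_)
    (hAi.const_mul _) (fun n => Eventually.of_forall fun x => ?_)
    (Eventually.of_forall fun x => ?_)
  · exact (((hA.mul (((hf n).1.continuous_fderiv (by simp)).clm_apply
      continuous_const).measurable).add (hB.mul (hf n).1.continuous.measurable)).comp
      hι).aestronglyMeasurable
  · by_cases hz : ι x ∈ K
    · rw [indicator_of_mem hz]
      have h1 : ‖fderiv ℝ (f n) (ι x) v‖ ≤ C * ‖v‖ :=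
        ((fderiv ℝ (f n) (ι x)).le_opNorm v).trans
          (mul_le_mul_of_nonneg_right (hC n _).2 (norm_nonneg _))
      have h2 := (hC n (ι x)).1
      calc ‖A (ι x) * fderiv ℝ (f n) (ι x) v + B (ι x) * f n (ι x)‖
          ≤ ‖A (ι x)‖ * ‖fderiv ℝ (f n) (ι x) v‖ + ‖B (ι x)‖ * ‖f n (ι x)‖ := by
            rw [← norm_mul, ← norm_mul]; exact norm_add_le _ _
        _ ≤ ‖A (ι x)‖ * (C * ‖v‖) + ‖B (ι x)‖ * C := by gcongr
        _ ≤ C * (‖v‖ + 1) * (‖A (ι x)‖ + ‖B (ι x)‖) := by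
            nlinarith [mul_nonneg (norm_nonneg (A (ι x))) hC0,
              mul_nonneg (norm_nonneg (B (ι x))) (mul_nonneg hC0 (norm_nonneg v))]
    · have hz' : ι x ∉ tsupport (f n) := fun h => hz ((hf n).2 h)
      rw [indicator_of_notMem hz, fderiv_eq_zero_of_notMem_tsupport hz',
        image_eq_zero_of_notMem_tsupport hz']
      simp
  · exact (((((ContinuousLinearMap.apply ℝ ℝ v).continuous.tendsto _).comp (hl _).2).const_mul
      _).add ((hl _).1.const_mul _))

/-- Almost every horizontal line is good for all test functions at the same time. -/
theorem PlaneSobolev.ae_slice {Ω : Set (ℝ × ℝ)} (hΩ : IsOpen Ω) {U G₁ G₂ : ℝ × ℝ → ℝ}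
    (h : PlaneSobolev Ω U G₁ G₂) :
    ∀ᵐ t : ℝ, ∀ φ : ℝ × ℝ → ℝ, ContDiff ℝ ∞ φ → HasCompactSupport φ → tsupport φ ⊆ Ω →
      ∫ x : ℝ, (U (x, t) * fderiv ℝ φ (x, t) (1, 0) + G₁ (x, t) * φ (x, t)) = 0 ∧
      ∫ z in {z : ℝ × ℝ | z.2 < t}, (U z * fderiv ℝ φ z (0, 1) + G₂ z * φ z) =
        ∫ x : ℝ, U (x, t) * φ (x, t) := by
  obtain ⟨K, hK, hKsup⟩ := exists_compact_exhaustion hΩ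
  choose S hSc hS hSd using fun n => exists_countable_dense_test (hK n).1
  have hcs : ∀ n φ, φ ∈ S n → HasCompactSupport φ := fun n φ hφ =>
    (hK n).1.of_isClosed_subset (isClosed_tsupport φ) (hS n φ hφ).2
  have e1 : ∀ᵐ t : ℝ, ∀ n, ∀ φ ∈ S n,
      ∫ x : ℝ, (U (x, t) * fderiv ℝ φ (x, t) (1, 0) + G₁ (x, t) * φ (x, t)) = 0 :=
    ae_all_iff.2 fun n => (ae_ball_iff (hSc n)).2 fun φ hφ =>
      h.slice_fst (hS n φ hφ).1 (hcs n φ hφ) ((hS n φ hφ).2.trans (hK n).2)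
  have e2 : ∀ᵐ t : ℝ, ∀ n, ∀ φ ∈ S n,
      (∫ z in {z : ℝ × ℝ | z.2 < t}, (U z * fderiv ℝ φ z (0, 1) + G₂ z * φ z)) -
        ∫ x : ℝ, U (x, t) * φ (x, t) = 0 :=
    ae_all_iff.2 fun n => (ae_ball_iff (hSc n)).2 fun φ hφ =>
      h.slice_snd (hS n φ hφ).1 (hcs n φ hφ) ((hS n φ hφ).2.trans (hK n).2)
  have hi : ∀ (A B : ℝ × ℝ → ℝ), MemLp A 2 volume → MemLp B 2 volume → ∀ n,
      Integrable ((K n).indicator fun z => ‖A z‖ + ‖B z‖) (volume : Measure (ℝ × ℝ)) := by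
    intro A B hA hB n
    have : IsFiniteMeasure ((volume : Measure (ℝ × ℝ)).restrict (K n)) :=
      ⟨by simpa using (hK n).1.measure_lt_top⟩
    rw [integrable_indicator_iff (hK n).1.measurableSet]
    exact ((hA.restrict (K n)).integrable (by norm_num)).norm.add
      ((hB.restrict (K n)).integrable (by norm_num)).norm
  have e3 : ∀ᵐ t : ℝ, ∀ n, Integrable (fun x : ℝ =>
      (K n).indicator (fun z => ‖U z‖ + ‖G₁ z‖) (x, t)) := by
    refine ae_all_iff.2 fun n => ?_
    have := hi U G₁ h.memLp h.memLp_fst n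
    rw [Measure.volume_eq_prod] at this
    exact this.prod_left_ae
  have e4 : ∀ᵐ t : ℝ, ∀ n, Integrable (fun x : ℝ =>
      (K n).indicator (fun z => ‖(0 : ℝ)‖ + ‖U z‖) (x, t)) := by
    refine ae_all_iff.2 fun n => ?_
    have := hi (fun _ => 0) U (by simp) h.memLp n
    rw [Measure.volume_eq_prod] at this
    exact this.prod_left_ae
  filter_upwards [e1, e2, e3, e4] with t h1 h2 h3 h4 φ hφ hc hs
  obtain ⟨n, hn⟩ := hKsup _ hc hs
  obtain ⟨f, C, hfS, hfC, hfl⟩ := hSd n φ hφ hn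
  have hm : Measurable fun x : ℝ => (x, t) := measurable_id.prodMk measurable_const
  have hf := fun k => hS n _ (hfS k)
  have t1 := tendsto_integral_test hm h.meas h.meas_fst (h3 n) (1, 0) hf hfC hfl
  simp only [fun k => h1 n _ (hfS k)] at t1
  -- With zero as the first coefficient only the boundary term of Green's formula remains; the
  -- direction `(1, 0)` is immaterial.
  have t2 := tendsto_integral_test hm measurable_const h.meas (h4 n) (1, 0) hf hfC hfl
  have t3 := tendsto_integral_test (μ := volume.restrict {z : ℝ × ℝ | z.2 < t}) measurable_id
    h.meas h.meas_snd (hi U G₂ h.memLp h.memLp_snd n).integrableOn (0, 1) hf hfC hfl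
  simp only [zero_mul, zero_add] at t2
  have h2' := fun k => sub_eq_zero.1 (h2 n _ (hfS k))
  simp only [id, h2'] at t3
  exact ⟨tendsto_nhds_unique tendsto_const_nhds t1 |>.symm, tendsto_nhds_unique t3 t2⟩

/-! ### Primitives on the components of an open set of finite length -/

/-- The last point of the complement of `G` before `x`. -/
noncomputable def leftEnd (G : Set ℝ) (x : ℝ) : ℝ := sSup {ξ | ξ ≤ x ∧ ξ ∉ G}

section LeftEnd

variable {G : Set ℝ}

theorem nonempty_leftEnd {x : ℝ} (hv : volume G ≠ ⊤) : {ξ | ξ ≤ x ∧ ξ ∉ G}.Nonempty := by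
  by_contra h
  rw [not_nonempty_iff_eq_empty, eq_empty_iff_forall_notMem] at h
  have h1 : Iic x ⊆ G := fun ξ hξ => by
    by_contra hG
    exact h ξ ⟨hξ, hG⟩
  exact hv (top_unique ((Real.volume_Iic (a := x)).symm.le.trans (measure_mono h1)))

theorem bddAbove_leftEnd (G : Set ℝ) (x : ℝ) : BddAbove {ξ | ξ ≤ x ∧ ξ ∉ G} :=
  ⟨x, fun _ h => h.1⟩

theorem leftEnd_mem (hG : IsOpen G) (hv : volume G ≠ ⊤) (x : ℝ) :
    leftEnd G x ≤ x ∧ leftEnd G x ∉ G :=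
  (isClosed_Iic.inter hG.isClosed_compl).csSup_mem (nonempty_leftEnd hv) (bddAbove_leftEnd G x)

theorem leftEnd_of_notMem {x : ℝ} (hx : x ∉ G) : leftEnd G x = x :=
  le_antisymm (csSup_le ⟨x, le_rfl, hx⟩ fun _ h => h.1)
    (le_csSup (bddAbove_leftEnd G x) ⟨le_rfl, hx⟩)

theorem Ioc_leftEnd_subset (x : ℝ) : Ioc (leftEnd G x) x ⊆ G := fun ξ hξ => by
  by_contra h
  exact not_lt.2 (le_csSup (bddAbove_leftEnd G x) ⟨hξ.2, h⟩) hξ.1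

theorem monotone_leftEnd (hv : volume G ≠ ⊤) : Monotone (leftEnd G) := fun _ y hxy =>
  csSup_le_csSup (bddAbove_leftEnd G y) (nonempty_leftEnd hv) fun _ h => ⟨h.1.trans hxy, h.2⟩

/-- A ball around `x` inside `G` contains no point of the complement, so moving `x` within it does
not change the set whose supremum is taken. -/
theorem leftEnd_eventuallyEq (hG : IsOpen G) {x : ℝ} (hx : x ∈ G) :
    ∀ᶠ y in 𝓝 x, leftEnd G y = leftEnd G x := by
  obtain ⟨ε, hε, hb⟩ := Metric.isOpen_iff.1 hG x hx
  filter_upwards [Metric.ball_mem_nhds x hε] with y hy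
  unfold leftEnd
  congr 1
  ext ξ
  refine and_congr_left fun hξ => ?_
  have hξb : ξ ∉ Metric.ball x ε := fun h => hξ (hb h)
  rw [Real.ball_eq_Ioo] at hy hξb
  constructor
  · intro h
    by_contra hlt
    exact hξb ⟨by linarith [hy.1], by linarith [hy.2]⟩
  · intro h
    by_contra hlt
    exact hξb ⟨by linarith [hy.1], by linarith [hy.2]⟩

theorem sub_leftEnd_le {Λ : ℝ} (hΛ : 0 ≤ Λ) (hv : volume G ≤ ENNReal.ofReal Λ) (x : ℝ) :
    x - leftEnd G x ≤ Λ := by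
  have h := (measure_mono (Ioc_leftEnd_subset (G := G) x)).trans hv
  rw [Real.volume_Ioc] at h
  exact (ENNReal.ofReal_le_ofReal_iff hΛ).1 h

end LeftEnd

theorem integral_mul_deriv_add_of_integral {f P α : ℝ → ℝ} (hf : Integrable f)
    (hP : ∀ x, P x = ∫ y in (0 : ℝ)..x, f y) (hα : ContDiff ℝ ∞ α) (hc : HasCompactSupport α) :
    ∫ x, P x * deriv α x = -∫ x, f x * α x := by
  have hP' : P = fun x => ∫ y in (0 : ℝ)..x, f y := funext hP
  obtain ⟨N, hN0, hN⟩ : ∃ N : ℝ, 0 < N ∧ tsupport α ⊆ Ioo (-N) N := by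
    obtain ⟨r, hr⟩ := hc.isBounded.subset_ball (0 : ℝ)
    refine ⟨max r 1, by positivity, fun x hx => ?_⟩
    have := hr hx
    rw [Real.ball_eq_Ioo] at this
    constructor <;> linarith [this.1, this.2, le_max_left r 1]
  have hz : ∀ x, x ∉ Ioo (-N) N → α x = 0 := fun x hx =>
    image_eq_zero_of_notMem_tsupport fun h => hx (hN h)
  have s1 : Function.support (fun x => P x * deriv α x) ⊆ Ioc (-N) N := by
    intro x hx
    refine Ioo_subset_Ioc_self (hN (support_deriv_subset (𝕜 := ℝ) ?_))
    exact right_ne_zero_of_mul hx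
  have s2 : Function.support (fun x => f x * α x) ⊆ Ioc (-N) N := by
    intro x hx
    exact Ioo_subset_Ioc_self (hN (subset_tsupport _ (right_ne_zero_of_mul hx)))
  rw [← intervalIntegral.integral_eq_integral_of_support_subset s1,
    ← intervalIntegral.integral_eq_integral_of_support_subset s2]
  have hfi : IntervalIntegrable f volume (-N) N := hf.intervalIntegrable
  have h0 : (0 : ℝ) ∈ uIcc (-N) N := by
    rw [uIcc_of_le (by linarith)]; exact ⟨by linarith, hN0.le⟩
  have hac : AbsolutelyContinuousOnInterval P (-N) N := by
    rw [hP']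
    exact hfi.absolutelyContinuousOnInterval_intervalIntegral h0
  have hαac : AbsolutelyContinuousOnInterval α (-N) N :=
    (hα.of_le (by simp)).contDiffOn.absolutelyContinuousOnInterval
  rw [hac.integral_mul_deriv_eq_deriv_mul hαac, hz N (by simp), hz (-N) (by simp)]
  have : ∫ x in (-N)..N, deriv P x * α x = ∫ x in (-N)..N, f x * α x := by
    refine intervalIntegral.integral_congr_ae ?_
    filter_upwards [hfi.ae_hasDerivAt_integral] with x hx hxm
    rw [hP', (hx (uIoc_subset_uIcc hxm) 0 h0).deriv]
  rw [this]
  ring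

/-- Take `w x = ∫ f` from `leftEnd G x` to `x`. It differs from a global primitive by a constant on
each component, which a test function supported in `G` does not see. Components have length at most
`Λ`, whence the Poincaré constant `Λ²`, without enumerating them. -/
theorem exists_componentwise_primitive {G : Set ℝ} (hG : IsOpen G) {Λ : ℝ} (hΛ : 0 ≤ Λ)
    (hv : volume G ≤ ENNReal.ofReal Λ) {f : ℝ → ℝ} (hfm : Measurable f) (hf : MemLp f 2 volume)
    (hf0 : ∀ x ∉ G, f x = 0) :
    ∃ w : ℝ → ℝ, Measurable w ∧ (∀ x ∉ G, w x = 0) ∧ (∃ C, ∀ x, ‖w x‖ ≤ C) ∧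
      ∫⁻ x, ‖w x‖ₑ ^ 2 ≤ ENNReal.ofReal (Λ ^ 2) * ∫⁻ x, ‖f x‖ₑ ^ 2 ∧
      ∀ α : ℝ → ℝ, ContDiff ℝ ∞ α → HasCompactSupport α → tsupport α ⊆ G →
        ∫ x, (w x * deriv α x + f x * α x) = 0 := by
  have hvt : volume G ≠ ⊤ := (hv.trans_lt ENNReal.ofReal_lt_top).ne
  have hfi : Integrable f := by
    have : IsFiniteMeasure (volume.restrict G) := ⟨by simpa using hvt.lt_top⟩
    have hGi : IntegrableOn f G := (hf.restrict G).integrable (by norm_num)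
    exact hGi.integrable_of_forall_notMem_eq_zero hf0
  set a := leftEnd G with ha
  have ham : Measurable a := (monotone_leftEnd hvt).measurable
  set P : ℝ → ℝ := fun x => ∫ y in (0 : ℝ)..x, f y with hP
  have hPc : Continuous P := intervalIntegral.continuous_primitive
    (fun _ _ => hfi.intervalIntegrable) 0
  have hPb : ∀ x, ‖P x‖ ≤ ∫ y, ‖f y‖ := fun x =>
    intervalIntegral.norm_integral_le_integral_norm_uIoc.trans
      (setIntegral_le_integral hfi.norm (Eventually.of_forall fun _ => norm_nonneg _))
  have hw : ∀ x, P x - P (a x) = ∫ y in Ioc (a x) x, f y := by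
    intro x
    rw [← intervalIntegral.integral_of_le (leftEnd_mem hG hvt x).1]
    exact intervalIntegral.integral_interval_sub_left hfi.intervalIntegrable hfi.intervalIntegrable
  refine ⟨fun x => P x - P (a x), hPc.measurable.sub (hPc.measurable.comp ham), fun x hx => ?_,
    ⟨2 * ∫ y, ‖f y‖, fun x => ?_⟩, ?_, ?_⟩
  · simp only [ha, leftEnd_of_notMem hx, sub_self]
  · linarith [norm_sub_le (P x) (P (a x)), hPb x, hPb (a x)]
  · have hS : MeasurableSet {q : ℝ × ℝ | a q.1 < q.2 ∧ q.2 ≤ q.1} :=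
      (measurableSet_lt (ham.comp measurable_fst) measurable_snd).inter
        (measurableSet_le measurable_snd measurable_fst)
    have h1 : ∀ x, ‖P x - P (a x)‖ₑ ^ 2 ≤ ENNReal.ofReal Λ *
        ∫⁻ ξ, {q : ℝ × ℝ | a q.1 < q.2 ∧ q.2 ≤ q.1}.indicator (fun q => ‖f q.2‖ₑ ^ 2) (x, ξ) := by
      intro x
      rw [hw]
      refine (pow_le_pow_left' (enorm_integral_le_lintegral_enorm _) 2).trans ?_
      refine (sq_lintegral_le_measure_mul _ hfm.enorm.aemeasurable).trans ?_
      rw [Measure.restrict_apply_univ, Real.volume_Ioc]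
      refine mul_le_mul' (ENNReal.ofReal_le_ofReal (sub_leftEnd_le hΛ hv x)) (le_of_eq ?_)
      rw [← lintegral_indicator measurableSet_Ioc]
      rfl
    refine (lintegral_mono h1).trans ?_
    rw [lintegral_const_mul' _ _ ENNReal.ofReal_ne_top, lintegral_lintegral_swap]
    · rw [sq Λ, ENNReal.ofReal_mul hΛ, mul_assoc]
      gcongr
      rw [← lintegral_const_mul' _ _ ENNReal.ofReal_ne_top]
      refine lintegral_mono fun ξ => ?_
      -- For fixed `ξ`, only points `x` of `[ξ, ξ + Λ]` have `ξ` between `a x` and `x`; integrating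
      -- in `x` first gives the second factor `Λ`.
      have h2 : ∀ x, {q : ℝ × ℝ | a q.1 < q.2 ∧ q.2 ≤ q.1}.indicator (fun q => ‖f q.2‖ₑ ^ 2) (x, ξ) ≤
          (Icc ξ (ξ + Λ)).indicator (fun _ => ‖f ξ‖ₑ ^ 2) x := by
        intro x
        refine indicator_apply_le' (fun hx => ?_) fun _ => zero_le
        rw [indicator_of_mem]
        have := sub_leftEnd_le hΛ hv x
        exact ⟨hx.2, by linarith [hx.1]⟩
      refine (lintegral_mono h2).trans (le_of_eq ?_)
      rw [lintegral_indicator_const measurableSet_Icc, Real.volume_Icc, mul_comm]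
      simp
    · exact (((hfm.comp measurable_snd).enorm.pow_const 2).indicator hS).aemeasurable
  · intro α hα hc hs
    have hαd : Continuous (deriv α) := hα.continuous_deriv (by simp)
    have hαi : Integrable (deriv α) := hαd.integrable_of_hasCompactSupport hc.deriv
    have i1 : Integrable fun x => P x * deriv α x :=
      hαi.bdd_mul hPc.aestronglyMeasurable (Eventually.of_forall hPb)
    have i2 : Integrable fun x => P (a x) * deriv α x :=
      hαi.bdd_mul (hPc.measurable.comp ham).aestronglyMeasurable
        (Eventually.of_forall fun x => hPb (a x))
    have i3 : Integrable fun x => f x * α x :=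
      hf.integrable_mul (q := 2) (hα.continuous.memLp_of_hasCompactSupport hc)
    have i4 : Integrable fun x => P (a x) * α x :=
      (hα.continuous.integrable_of_hasCompactSupport hc).bdd_mul
        (hPc.measurable.comp ham).aestronglyMeasurable (Eventually.of_forall fun x => hPb (a x))
    -- On `G`, which contains the support of `α`, the function `P ∘ a` is locally constant, so the
    -- integrand is the derivative of the integrable function `(P ∘ a) α`.
    have z2 : ∫ x, P (a x) * deriv α x = 0 := by
      refine integral_eq_zero_of_hasDerivAt_of_integrable (f := fun x => P (a x) * α x)
        (fun x => ?_) i2 i4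
      by_cases hx : x ∈ G
      · have h1 := ((hα.differentiable (by simp) x).hasDerivAt).const_mul (P (a x))
        refine h1.congr_of_eventuallyEq ?_
        filter_upwards [leftEnd_eventuallyEq hG hx] with y hy
        rw [ha, hy]
      · have hx' : x ∉ tsupport α := fun h => hx (hs h)
        have hd : deriv α x = 0 := by
          by_contra h
          exact hx' (support_deriv_subset (𝕜 := ℝ) h)
        rw [hd, mul_zero]
        refine (hasDerivAt_const x (0 : ℝ)).congr_of_eventuallyEq ?_
        filter_upwards [(isClosed_tsupport α).isOpen_compl.mem_nhds hx'] with y hy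
        rw [image_eq_zero_of_notMem_tsupport hy, mul_zero]
    have e : ∀ x, (P x - P (a x)) * deriv α x + f x * α x =
        (P x * deriv α x - P (a x) * deriv α x) + f x * α x := fun x => by ring
    simp only [e]
    have s1 := integral_add (i1.sub i2) i3
    simp only [Pi.sub_apply] at s1
    rw [s1, integral_sub i1 i2, z2, integral_mul_deriv_add_of_integral hfi (fun _ => rfl) hα hc]
    ring

/-! ### Cutting a Sobolev function along a horizontal line -/

/-- The properties of a horizontal line needed to cut along it. -/
structure GoodSlice (Ω : Set (ℝ × ℝ)) (U G₁ G₂ : ℝ × ℝ → ℝ) (t : ℝ) : Prop where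
  memLp : MemLp (fun x => U (x, t)) 2 volume
  memLp_fst : MemLp (fun x => G₁ (x, t)) 2 volume
  integral_fst : ∀ φ : ℝ × ℝ → ℝ, ContDiff ℝ ∞ φ → HasCompactSupport φ → tsupport φ ⊆ Ω →
      ∫ x : ℝ, (U (x, t) * fderiv ℝ φ (x, t) (1, 0) + G₁ (x, t) * φ (x, t)) = 0
  integral_snd : ∀ φ : ℝ × ℝ → ℝ, ContDiff ℝ ∞ φ → HasCompactSupport φ → tsupport φ ⊆ Ω →
      ∫ z in {z : ℝ × ℝ | z.2 < t}, (U z * fderiv ℝ φ z (0, 1) + G₂ z * φ z) =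
        ∫ x : ℝ, U (x, t) * φ (x, t)

theorem ae_memLp_slice {F : ℝ × ℝ → ℝ} (hm : Measurable F) (hF : MemLp F 2 volume) :
    ∀ᵐ t : ℝ, MemLp (fun x => F (x, t)) 2 volume := by
  have h1 := hF.integrable_sq
  rw [Measure.volume_eq_prod] at h1
  filter_upwards [h1.prod_left_ae] with t ht
  exact (memLp_two_iff_integrable_sq
    (hm.comp (measurable_id.prodMk measurable_const)).aestronglyMeasurable).2 ht

theorem PlaneSobolev.ae_goodSlice {Ω : Set (ℝ × ℝ)} (hΩ : IsOpen Ω) {U G₁ G₂ : ℝ × ℝ → ℝ}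
    (h : PlaneSobolev Ω U G₁ G₂) : ∀ᵐ t : ℝ, GoodSlice Ω U G₁ G₂ t := by
  filter_upwards [h.ae_slice hΩ, ae_memLp_slice h.meas h.memLp,
    ae_memLp_slice h.meas_fst h.memLp_fst] with t h1 h2 h3
  exact ⟨h2, h3, fun φ a b c => (h1 φ a b c).1, fun φ a b c => (h1 φ a b c).2⟩

theorem tsupport_slice_subset (φ : ℝ × ℝ → ℝ) (y : ℝ) :
    tsupport (fun x => φ (x, y)) ⊆ {x | (x, y) ∈ tsupport φ} :=
  closure_minimal (fun _ hx => subset_tsupport _ hx)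
    ((isClosed_tsupport φ).preimage (by fun_prop))

theorem hasCompactSupport_slice {φ : ℝ × ℝ → ℝ} (hc : HasCompactSupport φ) (y : ℝ) :
    HasCompactSupport fun x => φ (x, y) := by
  refine (hc.image continuous_fst).of_isClosed_subset (isClosed_tsupport _) fun x hx => ?_
  exact ⟨(x, y), tsupport_slice_subset φ y hx, rfl⟩

theorem hasCompactSupport_slice_left {φ : ℝ × ℝ → ℝ} (hc : HasCompactSupport φ) (x : ℝ) :
    HasCompactSupport fun y => φ (x, y) := by
  refine (hc.image continuous_snd).of_isClosed_subset (isClosed_tsupport _) fun y hy => ?_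
  refine ⟨(x, y), ?_, rfl⟩
  exact closure_minimal (s := Function.support fun y => φ (x, y)) (t := {y | (x, y) ∈ tsupport φ})
    (fun _ hx => subset_tsupport _ hx) ((isClosed_tsupport φ).preimage (by fun_prop)) hy

theorem hasDerivAt_slice {φ : ℝ × ℝ → ℝ} (hφ : ContDiff ℝ ∞ φ) (x y : ℝ) :
    HasDerivAt (fun x => φ (x, y)) (fderiv ℝ φ (x, y) (1, 0)) x := by
  have h1 := (hφ.differentiable (by simp) (x, y)).hasFDerivAt
  exact h1.comp_hasDerivAt x ((hasDerivAt_id x).prodMk (hasDerivAt_const x y))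

theorem hasDerivAt_slice_left {φ : ℝ × ℝ → ℝ} (hφ : ContDiff ℝ ∞ φ) (x y : ℝ) :
    HasDerivAt (fun y => φ (x, y)) (fderiv ℝ φ (x, y) (0, 1)) y := by
  have h1 := (hφ.differentiable (by simp) (x, y)).hasFDerivAt
  exact h1.comp_hasDerivAt y ((hasDerivAt_const y x).prodMk (hasDerivAt_id y))

theorem fderiv_prod_mul {α χ : ℝ → ℝ} (hα : ContDiff ℝ ∞ α) (hχ : ContDiff ℝ ∞ χ) (x y : ℝ) :
    fderiv ℝ (fun z : ℝ × ℝ => α z.1 * χ z.2) (x, y) (1, 0) = deriv α x * χ y := by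
  have hφ : ContDiff ℝ ∞ (fun z : ℝ × ℝ => α z.1 * χ z.2) := by fun_prop
  rw [← (hasDerivAt_slice hφ x y).deriv]
  simp

/-- On a good line, the restriction of `U` has the expected weak derivative. -/
theorem GoodSlice.integral_eq_zero {h : ℝ → ℝ} (hh : Continuous h) {U G₁ G₂ : ℝ × ℝ → ℝ}
    {t : ℝ} (ht : 0 < t) (hg : GoodSlice (filmDomain h) U G₁ G₂ t) {α : ℝ → ℝ}
    (hα : ContDiff ℝ ∞ α) (hc : HasCompactSupport α) (hs : tsupport α ⊆ {x | t < h x}) :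
    ∫ x, (U (x, t) * deriv α x + G₁ (x, t) * α x) = 0 := by
  -- By compactness `h - t` has a positive minimum on the support of `α`, leaving room for a bump in
  -- `y` around `t` whose product with `α` is supported in the film.
  obtain ⟨δ, hδ, hδt, hδh⟩ : ∃ δ, 0 < δ ∧ δ < t ∧ ∀ x ∈ tsupport α, t + δ < h x := by
    rcases (tsupport α).eq_empty_or_nonempty with he | hne
    · exact ⟨t / 2, by linarith, by linarith, by simp [he]⟩
    · obtain ⟨x₀, hx₀, hmin⟩ := hc.exists_isMinOn hne hh.continuousOn
      have h1 : t < h x₀ := hs hx₀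
      refine ⟨min (t / 2) ((h x₀ - t) / 2), by
        apply lt_min <;> linarith, by
        linarith [min_le_left (t / 2) ((h x₀ - t) / 2)], fun x hx => ?_⟩
      have h2 : h x₀ ≤ h x := hmin hx
      linarith [min_le_right (t / 2) ((h x₀ - t) / 2)]
  let χ : ContDiffBump t := ⟨δ / 2, δ, by linarith, by linarith⟩
  have hχ : ContDiff ℝ ∞ χ := χ.contDiff
  have hφ : ContDiff ℝ ∞ (fun z : ℝ × ℝ => α z.1 * χ z.2) := by fun_prop
  have hsub : tsupport (fun z : ℝ × ℝ => α z.1 * χ z.2) ⊆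
      tsupport α ×ˢ Metric.closedBall t δ := by
    refine closure_minimal (fun z hz => ⟨subset_tsupport _ (left_ne_zero_of_mul hz), ?_⟩)
      ((isClosed_tsupport α).prod Metric.isClosed_closedBall)
    have h1 : z.2 ∈ Function.support χ := right_ne_zero_of_mul hz
    rw [χ.support_eq] at h1
    exact Metric.ball_subset_closedBall h1
  have hcs : HasCompactSupport (fun z : ℝ × ℝ => α z.1 * χ z.2) :=
    (hc.prod (isCompact_closedBall t δ)).of_isClosed_subset (isClosed_tsupport _) hsub
  have h0 := hg.integral_fst _ hφ hcs (hsub.trans ?_)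
  · simp only [fderiv_prod_mul hα hχ] at h0
    have h1 : χ t = 1 := χ.one_of_mem_closedBall (Metric.mem_closedBall_self (by
      change 0 ≤ δ / 2; linarith))
    simpa only [h1, mul_one] using h0
  · rintro ⟨x, y⟩ ⟨hx, hy⟩
    simp only at hx hy
    rw [Real.closedBall_eq_Icc] at hy
    exact ⟨by simp only; linarith [hy.1], by simp only; linarith [hy.2, hδh x hx]⟩

/-- A test function on `filmDomain k` can be changed above the height `t` into a test function
on `filmDomain h`, if the two domains agree up to a larger height. -/
theorem exists_cutoff_test {h k : ℝ → ℝ} {s t : ℝ} (hts : t < s)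
    (hhk : ∀ x, k x = h x ∨ (s ≤ h x ∧ s ≤ k x)) {φ : ℝ × ℝ → ℝ} (hφ : ContDiff ℝ ∞ φ)
    (hc : HasCompactSupport φ) (hs : tsupport φ ⊆ filmDomain k) :
    ∃ φ' : ℝ × ℝ → ℝ, ContDiff ℝ ∞ φ' ∧ HasCompactSupport φ' ∧ tsupport φ' ⊆ filmDomain h ∧
      (∀ z, z.2 ≤ t → φ' z = φ z) ∧ ∀ z, z.2 < t → fderiv ℝ φ' z = fderiv ℝ φ z := by
  set δ := (s - t) / 2 with hδ
  have hδ0 : 0 < δ := by linarith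
  -- A cutoff equal to one up to `t` and to zero beyond the midpoint of `t` and `s`; below `s` the
  -- two films coincide.
  set χ : ℝ → ℝ := fun y => 1 - Real.smoothTransition ((y - t) / δ) with hχdef
  have hχ : ContDiff ℝ ∞ χ :=
    contDiff_const.sub (Real.smoothTransition.contDiff.comp
      ((contDiff_id.sub contDiff_const).div_const δ))
  have h1 : ∀ y, y ≤ t → χ y = 1 := fun y hy => by
    simp only [hχdef]
    rw [Real.smoothTransition.zero_of_nonpos (div_nonpos_of_nonpos_of_nonneg (by linarith) hδ0.le),
      sub_zero]
  have h0 : ∀ y, t + δ ≤ y → χ y = 0 := fun y hy => by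
    simp only [hχdef]
    rw [Real.smoothTransition.one_of_one_le ((one_le_div hδ0).2 (by linarith)), sub_self]
  refine ⟨fun z => φ z * χ z.2, hφ.mul (hχ.comp contDiff_snd), hc.mul_right, ?_,
    fun z hz => by simp only [h1 _ hz, mul_one], fun z hz => ?_⟩
  · have hsub : tsupport (fun z : ℝ × ℝ => φ z * χ z.2) ⊆ tsupport φ ∩ {z | z.2 ≤ t + δ} := by
      refine closure_minimal (fun z hz => ⟨subset_tsupport _ (left_ne_zero_of_mul hz), ?_⟩)
        ((isClosed_tsupport φ).inter (isClosed_le continuous_snd continuous_const))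
      by_contra hlt
      exact right_ne_zero_of_mul hz (h0 _ (not_le.1 hlt).le)
    intro z hz
    obtain ⟨hz1, hz2⟩ := hsub hz
    have hz3 := hs hz1
    have hz2 : z.2 ≤ t + δ := hz2
    refine ⟨hz3.1, ?_⟩
    rcases hhk z.1 with he | he
    · rw [← he]; exact hz3.2
    · have := he.1
      linarith
  · refine Filter.EventuallyEq.fderiv_eq ?_
    filter_upwards [(isOpen_lt continuous_snd continuous_const).mem_nhds hz] with z' hz'
    have hz' : z'.2 < t := hz'
    simp only [h1 _ hz'.le, mul_one]

theorem restrict_preimage_snd (T : Set ℝ) :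
    (volume : Measure (ℝ × ℝ)).restrict {z | z.2 ∈ T} = volume.prod (volume.restrict T) := by
  have : {z : ℝ × ℝ | z.2 ∈ T} = univ ×ˢ T := by ext; simp
  rw [this, Measure.volume_eq_prod, ← Measure.prod_restrict, Measure.restrict_univ]

theorem memLp_mul_prod {β γ : ℝ → ℝ} (hβ : MemLp β 2 volume) (hγ : MemLp γ 2 volume) :
    MemLp (fun z : ℝ × ℝ => β z.1 * γ z.2) 2 volume := by
  have hm : AEStronglyMeasurable (fun z : ℝ × ℝ => β z.1 * γ z.2) volume :=
    (hβ.aestronglyMeasurable.comp_fst).mul (hγ.aestronglyMeasurable.comp_snd)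
  refine (memLp_two_iff_integrable_sq hm).2 ?_
  simp only [mul_pow]
  exact hβ.integrable_sq.mul_prod hγ.integrable_sq

/-! ### Exponential continuation above a horizontal line -/

/-- The exponential profile used to continue a function above the height `t`. -/
noncomputable def decay (Λ t y : ℝ) : ℝ := Real.exp (-(y - t) / Λ)

theorem contDiff_decay (Λ t : ℝ) : ContDiff ℝ ∞ (decay Λ t) := by
  unfold decay; fun_prop

theorem hasDerivAt_decay (Λ t y : ℝ) :
    HasDerivAt (decay Λ t) (-(1 / Λ) * decay Λ t y) y := by
  have := ((((hasDerivAt_id y).sub_const t).neg).div_const Λ).exp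
  convert! this using 1
  simp only [decay, id, Pi.neg_apply]
  ring

theorem decay_self (Λ t : ℝ) : decay Λ t t = 1 := by simp [decay]

theorem decay_le_one {Λ t y : ℝ} (hΛ : 0 < Λ) (hy : t ≤ y) : decay Λ t y ≤ 1 :=
  Real.exp_le_one_iff.2 (div_nonpos_of_nonpos_of_nonneg (by linarith) hΛ.le)

theorem decay_pos (Λ t y : ℝ) : 0 < decay Λ t y := Real.exp_pos _

theorem integral_decay_sq {Λ : ℝ} (hΛ : 0 < Λ) (t : ℝ) :
    IntegrableOn (fun y => decay Λ t y ^ 2) (Ici t) ∧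
      ∫ y in Ici t, decay Λ t y ^ 2 = Λ / 2 := by
  have hd : ∀ y, HasDerivAt (fun y => -(Λ / 2) * decay Λ t y ^ 2) (decay Λ t y ^ 2) y := by
    intro y
    have := ((hasDerivAt_decay Λ t y).pow 2).const_mul (-(Λ / 2))
    convert! this using 1
    field_simp
    norm_num
    ring
  have hl : Tendsto (fun y => -(Λ / 2) * decay Λ t y ^ 2) atTop (𝓝 0) := by
    have h1 : Tendsto (fun y : ℝ => -(y - t) / Λ) atTop atBot := by
      refine Tendsto.atBot_div_const hΛ ?_
      exact tendsto_neg_atTop_atBot.comp (tendsto_atTop_add_const_right _ (-t) tendsto_id)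
    have h2 : Tendsto (decay Λ t) atTop (𝓝 0) := Real.tendsto_exp_atBot.comp h1
    simpa using (h2.pow 2).const_mul (-(Λ / 2))
  rw [integrableOn_Ici_iff_integrableOn_Ioi, integral_Ici_eq_integral_Ioi]
  refine ⟨integrableOn_Ioi_deriv_of_nonneg' (fun y _ => hd y) (fun y _ => sq_nonneg _) hl, ?_⟩
  rw [integral_Ioi_of_hasDerivAt_of_nonneg' (fun y _ => hd y) (fun y _ => sq_nonneg _) hl,
    decay_self]
  ring

theorem lintegral_decay_sq {Λ : ℝ} (hΛ : 0 < Λ) (t : ℝ) :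
    ∫⁻ y in Ici t, ENNReal.ofReal (decay Λ t y ^ 2) = ENNReal.ofReal (Λ / 2) := by
  rw [← ofReal_integral_eq_lintegral_ofReal (integral_decay_sq hΛ t).1
    (Eventually.of_forall fun y => sq_nonneg _), (integral_decay_sq hΛ t).2]

theorem memLp_indicator_decay {Λ : ℝ} (hΛ : 0 < Λ) (t : ℝ) :
    MemLp ((Ici t).indicator (decay Λ t)) 2 volume := by
  rw [memLp_indicator_iff_restrict measurableSet_Ici]
  exact (memLp_two_iff_integrable_sq
    (contDiff_decay Λ t).continuous.aestronglyMeasurable).2 (integral_decay_sq hΛ t).1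

/-- Below the height `t`, the weak derivative in the horizontal direction is unchanged. -/
theorem PlaneSobolev.integral_fst_below {Ω : Set (ℝ × ℝ)} {U G₁ G₂ : ℝ × ℝ → ℝ}
    (h : PlaneSobolev Ω U G₁ G₂) {φ : ℝ × ℝ → ℝ} (hφ : ContDiff ℝ ∞ φ)
    (hc : HasCompactSupport φ) (hs : tsupport φ ⊆ Ω) (t : ℝ) :
    ∫ z in {z : ℝ × ℝ | z.2 < t}, (U z * fderiv ℝ φ z (1, 0) + G₁ z * φ z) = 0 := by
  have hi : IntegrableOn (fun z => U z * fderiv ℝ φ z (1, 0) + G₁ z * φ z)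
      {z : ℝ × ℝ | z.2 ∈ Iio t} :=
    (integrable_mul_fderiv (h.memLp.restrict _) hφ hc (1, 0)).add
      (integrable_mul_test (h.memLp_fst.restrict _) hφ.continuous hc)
  change ∫ z in {z : ℝ × ℝ | z.2 ∈ Iio t}, _ = 0
  rw [IntegrableOn, restrict_preimage_snd] at hi
  rw [restrict_preimage_snd, integral_prod_symm _ hi]
  refine integral_eq_zero_of_ae ?_
  filter_upwards [ae_restrict_of_ae (h.slice_fst hφ hc hs)] with y hy using hy

/-- Both `v` and `w` have weak derivative `f` on `G`, so `v + (decay - 1) w` has derivative `decay ·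
f`. The slices of `φ` at heights `y ≥ t` are supported in `{k > y}`, hence in `G`. -/
theorem integral_test_above_fst {v w f : ℝ → ℝ} {Λ t : ℝ} {k : ℝ → ℝ} {G : Set ℝ}
    (hGk : ∀ x, t < k x → x ∈ G) (hv : MemLp v 2 volume) (hw : MemLp w 2 volume)
    (hf : MemLp f 2 volume)
    (h1 : ∀ α : ℝ → ℝ, ContDiff ℝ ∞ α → HasCompactSupport α → tsupport α ⊆ G →
        ∫ x, (v x * deriv α x + f x * α x) = 0)
    (h2 : ∀ α : ℝ → ℝ, ContDiff ℝ ∞ α → HasCompactSupport α → tsupport α ⊆ G →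
        ∫ x, (w x * deriv α x + f x * α x) = 0)
    {φ : ℝ × ℝ → ℝ} (hφ : ContDiff ℝ ∞ φ) (hc : HasCompactSupport φ)
    (hs : tsupport φ ⊆ filmDomain k)
    (hi : IntegrableOn (fun z : ℝ × ℝ => (v z.1 + (decay Λ t z.2 - 1) * w z.1) *
      fderiv ℝ φ z (1, 0) + f z.1 * decay Λ t z.2 * φ z) {z : ℝ × ℝ | z.2 ∈ Ici t}) :
    ∫ z in {z : ℝ × ℝ | z.2 ∈ Ici t}, ((v z.1 + (decay Λ t z.2 - 1) * w z.1) *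
      fderiv ℝ φ z (1, 0) + f z.1 * decay Λ t z.2 * φ z) = 0 := by
  rw [IntegrableOn, restrict_preimage_snd] at hi
  rw [restrict_preimage_snd, integral_prod_symm _ hi]
  refine setIntegral_eq_zero_of_forall_eq_zero fun y hy => ?_
  have hα : ContDiff ℝ ∞ fun x => φ (x, y) := hφ.comp (contDiff_id.prodMk contDiff_const)
  have hαc : HasCompactSupport fun x => φ (x, y) := hasCompactSupport_slice hc y
  have hαs : tsupport (fun x => φ (x, y)) ⊆ G := fun x hx => by
    have := hs (tsupport_slice_subset φ y hx)
    exact hGk x (lt_of_le_of_lt hy this.2)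
  have hd : ∀ x, fderiv ℝ φ (x, y) (1, 0) = deriv (fun x => φ (x, y)) x := fun x =>
    (hasDerivAt_slice hφ x y).deriv.symm
  have m0 := hα.continuous.memLp_of_hasCompactSupport (μ := volume) (p := 2) hαc
  have m1 := (hα.continuous_deriv (by simp)).memLp_of_hasCompactSupport (μ := volume) (p := 2)
    hαc.deriv
  have e : ∀ x, (v x + (decay Λ t y - 1) * w x) * fderiv ℝ φ (x, y) (1, 0) +
      f x * decay Λ t y * φ (x, y) =
      (v x * deriv (fun x => φ (x, y)) x + f x * φ (x, y)) +
      (decay Λ t y - 1) * (w x * deriv (fun x => φ (x, y)) x + f x * φ (x, y)) := by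
    intro x
    rw [hd]
    ring
  simp only [e]
  have iv : Integrable fun x => v x * deriv (fun x => φ (x, y)) x + f x * φ (x, y) :=
    (hv.integrable_mul (q := 2) m1).add (hf.integrable_mul (q := 2) m0)
  have iw : Integrable fun x => w x * deriv (fun x => φ (x, y)) x + f x * φ (x, y) :=
    (hw.integrable_mul (q := 2) m1).add (hf.integrable_mul (q := 2) m0)
  rw [integral_add iv (iw.const_mul _), integral_const_mul, h1 _ hα hαc hαs, h2 _ hα hαc hαs]
  simp

/-- The fundamental theorem of calculus on vertical half-lines. As `decay` is one at the height `t`,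
the boundary term is that of the slice `v` and cancels the one from below in
`GoodSlice.integral_snd`. -/
theorem integral_test_above_snd {v w : ℝ → ℝ} {Λ t : ℝ}
    {φ : ℝ × ℝ → ℝ} (hφ : ContDiff ℝ ∞ φ) (hc : HasCompactSupport φ)
    (hi : IntegrableOn (fun z : ℝ × ℝ => (v z.1 + (decay Λ t z.2 - 1) * w z.1) *
      fderiv ℝ φ z (0, 1) + -(1 / Λ) * (w z.1 * decay Λ t z.2) * φ z)
      {z : ℝ × ℝ | z.2 ∈ Ici t}) :
    ∫ z in {z : ℝ × ℝ | z.2 ∈ Ici t}, ((v z.1 + (decay Λ t z.2 - 1) * w z.1) *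
      fderiv ℝ φ z (0, 1) + -(1 / Λ) * (w z.1 * decay Λ t z.2) * φ z) =
      -∫ x, v x * φ (x, t) := by
  rw [IntegrableOn, restrict_preimage_snd] at hi
  rw [restrict_preimage_snd, integral_prod _ hi, ← integral_neg]
  refine integral_congr_ae (Eventually.of_forall fun x => ?_)
  have hα : ContDiff ℝ ∞ fun y => φ (x, y) := hφ.comp (contDiff_const.prodMk contDiff_id)
  have hαc : HasCompactSupport fun y => φ (x, y) := hasCompactSupport_slice_left hc x
  have hF : ContDiff ℝ 1 fun y => (v x + (decay Λ t y - 1) * w x) * φ (x, y) :=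
    ((contDiff_const.add (((contDiff_decay Λ t).sub contDiff_const).mul contDiff_const)).mul
      hα).of_le (by simp)
  have hFc : HasCompactSupport fun y => (v x + (decay Λ t y - 1) * w x) * φ (x, y) :=
    hαc.mul_left
  have hd : ∀ y, deriv (fun y => (v x + (decay Λ t y - 1) * w x) * φ (x, y)) y =
      (v x + (decay Λ t y - 1) * w x) * fderiv ℝ φ (x, y) (0, 1) +
      -(1 / Λ) * (w x * decay Λ t y) * φ (x, y) := by
    intro y
    have h1 := (((((hasDerivAt_decay Λ t y).sub_const 1).mul_const (w x)).const_add
      (v x)).mul (hasDerivAt_slice_left hφ x y)).deriv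
    refine Eq.trans ?_ (h1.trans ?_)
    · rfl
    · ring
  simp only [← hd]
  rw [integral_Ici_eq_integral_Ioi, hFc.integral_Ioi_deriv_eq hF, decay_self]
  ring

/-- The function which agrees with `U` below the height `t`, and which above decays
exponentially to a constant on each component of the superlevel set of the profile. -/
theorem exists_competitor {h k : ℝ → ℝ} (hh : Continuous h) (hkc : Continuous k) {M : ℝ}
    (hkM : ∀ x, k x ≤ M) {s t Λ : ℝ} (ht : 0 < t) (hts : t < s) (hΛ : 0 < Λ)
    (hhk : ∀ x, k x = h x ∨ (s ≤ h x ∧ s ≤ k x))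
    (hvol : volume {x | t < h x} ≤ ENNReal.ofReal Λ) {U G₁ G₂ : ℝ × ℝ → ℝ}
    (hU : PlaneSobolev (filmDomain h) U G₁ G₂) (hg : GoodSlice (filmDomain h) U G₁ G₂ t) :
    ∃ U' H₁ H₂ : ℝ × ℝ → ℝ, PlaneSobolev (filmDomain k) U' H₁ H₂ ∧
      (∀ z, z.2 < t → U' z = U z) ∧
      ∫⁻ z in filmDomain k, ENNReal.ofReal (H₁ z ^ 2 + H₂ z ^ 2) ≤
        (∫⁻ z in {z : ℝ × ℝ | z.2 < t}, ENNReal.ofReal (G₁ z ^ 2 + G₂ z ^ 2)) +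
          ENNReal.ofReal Λ * ∫⁻ x, ‖G₁ (x, t)‖ₑ ^ 2 := by
  classical
  set G : Set ℝ := {x | t < h x} with hG
  have hGo : IsOpen G := isOpen_lt continuous_const hh
  have hGk : ∀ x, t < k x → x ∈ G := by
    intro x hx
    rcases hhk x with he | he
    · rw [he] at hx; exact hx
    · exact lt_of_lt_of_le hts he.1
  set f : ℝ → ℝ := fun x => G₁ (x, t) with hf
  set v : ℝ → ℝ := fun x => U (x, t) with hv
  have hmt : Measurable fun x : ℝ => (x, t) := measurable_id.prodMk measurable_const
  have hfm : Measurable f := hU.meas_fst.comp hmt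
  have hvm : Measurable v := hU.meas.comp hmt
  have hf0 : ∀ x ∉ G, f x = 0 := fun x hx => hU.zero_fst _ fun hz => hx hz.2
  obtain ⟨w, hwm, hw0, ⟨C, hwC⟩, hwE, hwα⟩ :=
    exists_componentwise_primitive hGo hΛ.le hvol hfm hg.memLp_fst hf0
  have hvG : volume G < ⊤ := hvol.trans_lt ENNReal.ofReal_lt_top
  have hw2 : MemLp w 2 volume := by
    have : IsFiniteMeasure (volume.restrict G) := ⟨by simpa using hvG⟩
    have h1 : MemLp w 2 (volume.restrict G) :=
      MemLp.of_bound hwm.aestronglyMeasurable C (Eventually.of_forall hwC)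
    have h2 : G.indicator w = w := indicator_eq_self.2 fun x hx => by
      by_contra hxG
      exact hx (hw0 x hxG)
    rw [← h2, memLp_indicator_iff_restrict hGo.measurableSet]
    exact h1
  set Ω := filmDomain k with hΩ
  have hΩo : IsOpen Ω := isOpen_filmDomain hkc
  have hΩm : MeasurableSet Ω := hΩo.measurableSet
  set S : Set (ℝ × ℝ) := {z | z.2 < t} with hS
  have hSm : MeasurableSet S := measurableSet_lt measurable_snd measurable_const
  have hSc : Sᶜ = {z : ℝ × ℝ | z.2 ∈ Ici t} := by ext z; simp [hS]
  have hdm : Measurable (decay Λ t) := (contDiff_decay Λ t).continuous.measurable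
  -- At `y = t` this is the slice `v`; as `y → ∞` it tends to `v - w`, whose weak derivative
  -- vanishes on `G`. Both partial derivatives `b₁`, `b₂` carry the factor `decay`.
  set a : ℝ × ℝ → ℝ := fun z => v z.1 + (decay Λ t z.2 - 1) * w z.1 with ha
  set b₁ : ℝ × ℝ → ℝ := fun z => f z.1 * decay Λ t z.2 with hb₁
  set b₂ : ℝ × ℝ → ℝ := fun z => -(1 / Λ) * (w z.1 * decay Λ t z.2) with hb₂
  have ham : Measurable a := (hvm.comp measurable_fst).add
    (((hdm.comp measurable_snd).sub_const 1).mul (hwm.comp measurable_fst))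
  have hb₁m : Measurable b₁ := (hfm.comp measurable_fst).mul (hdm.comp measurable_snd)
  have hb₂m : Measurable b₂ := ((hwm.comp measurable_fst).mul (hdm.comp measurable_snd)).const_mul _
  -- square integrability of the pieces above the height `t`
  have hdecay := memLp_indicator_decay hΛ t
  have hmul : ∀ β : ℝ → ℝ, Measurable β → MemLp β 2 volume →
      MemLp (fun z : ℝ × ℝ => β z.1 * decay Λ t z.2) 2 (volume.restrict Sᶜ) := by
    intro β hβm hβ
    refine ((memLp_mul_prod hβ hdecay).restrict Sᶜ).congr_norm
      ((hβm.comp measurable_fst).mul (hdm.comp measurable_snd)).aestronglyMeasurable ?_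
    filter_upwards [ae_restrict_mem hSm.compl] with z hz
    rw [hSc] at hz
    simp only [indicator_of_mem (show z.2 ∈ Ici t from hz)]
  have hb₁2 : MemLp b₁ 2 (volume.restrict Sᶜ) := hmul f hfm hg.memLp_fst
  have hb₂2 : MemLp b₂ 2 (volume.restrict Sᶜ) := (hmul w hwm hw2).const_mul _
  -- Unlike its gradient, `a` does not decay in `y`; it is square integrable on the film because `k
  -- ≤ M`.
  have ha2 : MemLp (Ω.indicator a) 2 (volume.restrict Sᶜ) := by
    have h1 : MemLp (fun x => |v x| + |w x|) 2 volume := hg.memLp.norm.add hw2.norm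
    have h2 : MemLp ((Icc 0 M).indicator fun _ : ℝ => (1 : ℝ)) 2 volume :=
      memLp_indicator_const 2 measurableSet_Icc 1 (Or.inr (by simp))
    refine ((memLp_mul_prod h1 h2).restrict Sᶜ).mono (ham.indicator hΩm).aestronglyMeasurable ?_
    filter_upwards [ae_restrict_mem hSm.compl] with z hz
    rw [hSc] at hz
    have hz : t ≤ z.2 := hz
    by_cases hzΩ : z ∈ Ω
    · rw [indicator_of_mem hzΩ, indicator_of_mem
        (show z.2 ∈ Icc 0 M from ⟨hzΩ.1.le, hzΩ.2.le.trans (hkM _)⟩), mul_one,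
        Real.norm_eq_abs, Real.norm_of_nonneg (by positivity)]
      refine (abs_add_le _ _).trans (add_le_add le_rfl ?_)
      rw [abs_mul]
      refine mul_le_of_le_one_left (abs_nonneg _) ?_
      rw [abs_le]
      constructor <;> linarith [decay_le_one hΛ hz, decay_pos Λ t z.2]
    · rw [indicator_of_notMem hzΩ, norm_zero]
      exact norm_nonneg _
  have hzero : ∀ z, z ∉ Ω → z ∈ S → z ∉ filmDomain h := by
    rintro z hzΩ hzS ⟨h1, h2⟩
    refine hzΩ ⟨h1, ?_⟩
    rcases hhk z.1 with he | he
    · rw [he]; exact h2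
    · have : z.2 < t := hzS
      linarith [he.2]
  have hP : ∀ (F b : ℝ × ℝ → ℝ), MemLp F 2 volume → MemLp (Ω.indicator b) 2 (volume.restrict Sᶜ) →
      MemLp (S.piecewise F (Ω.indicator b)) 2 volume := fun F b hF hb =>
    MemLp.piecewise hSm (hF.restrict S) hb
  have hz0 : ∀ (F b : ℝ × ℝ → ℝ), (∀ z ∉ filmDomain h, F z = 0) → ∀ z ∉ Ω,
      S.piecewise F (Ω.indicator b) z = 0 := by
    intro F b hF z hz
    by_cases hzS : z ∈ S
    · rw [piecewise_eq_of_mem _ _ _ hzS, hF z (hzero z hz hzS)]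
    · rw [piecewise_eq_of_notMem _ _ _ hzS, indicator_of_notMem hz]
  have hU' := hP U a hU.memLp ha2
  have hH₁ := hP G₁ b₁ hU.memLp_fst (hb₁2.indicator hΩm)
  have hH₂ := hP G₂ b₂ hU.memLp_snd (hb₂2.indicator hΩm)
  -- splitting of the integrals against test functions
  have split : ∀ (F b φ : ℝ × ℝ → ℝ) (e : ℝ × ℝ),
      MemLp (S.piecewise F (Ω.indicator b)) 2 volume → ContDiff ℝ ∞ φ → HasCompactSupport φ →
      tsupport φ ⊆ Ω →
      IntegrableOn (fun z => a z * fderiv ℝ φ z e + b z * φ z) {z : ℝ × ℝ | z.2 ∈ Ici t} ∧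
      ∫ z, (S.piecewise U (Ω.indicator a) z * fderiv ℝ φ z e +
        S.piecewise F (Ω.indicator b) z * φ z) =
        (∫ z in S, (U z * fderiv ℝ φ z e + F z * φ z)) +
        ∫ z in {z : ℝ × ℝ | z.2 ∈ Ici t}, (a z * fderiv ℝ φ z e + b z * φ z) := by
    intro F b φ e hFb hφ hc hs
    have i0 : Integrable (fun z => S.piecewise U (Ω.indicator a) z * fderiv ℝ φ z e +
        S.piecewise F (Ω.indicator b) z * φ z) (volume : Measure (ℝ × ℝ)) := by
      have i1 := integrable_mul_fderiv (Ω := univ) (by simpa using hU') hφ hc e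
      have i2 := integrable_mul_test (Ω := univ) (by simpa using hFb) hφ.continuous hc
      rw [integrableOn_univ] at i1 i2
      exact i1.add i2
    have eS : ∀ z ∈ Sᶜ, S.piecewise U (Ω.indicator a) z * fderiv ℝ φ z e +
        S.piecewise F (Ω.indicator b) z * φ z = a z * fderiv ℝ φ z e + b z * φ z := by
      intro z hz
      rw [piecewise_eq_of_notMem _ _ _ hz, piecewise_eq_of_notMem _ _ _ hz]
      by_cases hzΩ : z ∈ Ω
      · rw [indicator_of_mem hzΩ, indicator_of_mem hzΩ]
      · have hz' : z ∉ tsupport φ := fun h => hzΩ (hs h)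
        rw [fderiv_eq_zero_of_notMem_tsupport hz', image_eq_zero_of_notMem_tsupport hz']
        simp
    rw [← hSc]
    refine ⟨i0.integrableOn.congr_fun eS hSm.compl, ?_⟩
    rw [← integral_add_compl hSm i0, setIntegral_congr_fun hSm.compl eS]
    congr 1
    refine setIntegral_congr_fun hSm fun z hz => ?_
    simp only [piecewise_eq_of_mem _ _ _ hz]
  have below : ∀ (F φ φ' : ℝ × ℝ → ℝ) (e : ℝ × ℝ), (∀ z, z.2 ≤ t → φ' z = φ z) →
      (∀ z, z.2 < t → fderiv ℝ φ' z = fderiv ℝ φ z) →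
      ∫ z in S, (U z * fderiv ℝ φ z e + F z * φ z) =
      ∫ z in S, (U z * fderiv ℝ φ' z e + F z * φ' z) := by
    intro F φ φ' e h1 h2
    refine setIntegral_congr_fun hSm fun z hz => ?_
    have hz : z.2 < t := hz
    simp only [h1 z hz.le, h2 z hz]
  refine ⟨S.piecewise U (Ω.indicator a), S.piecewise G₁ (Ω.indicator b₁),
    S.piecewise G₂ (Ω.indicator b₂), ⟨hU.meas.piecewise hSm (ham.indicator hΩm),
    hU.meas_fst.piecewise hSm (hb₁m.indicator hΩm), hU.meas_snd.piecewise hSm (hb₂m.indicator hΩm),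
    hU', hH₁, hH₂, hz0 _ _ hU.zero_fst, hz0 _ _ hU.zero_snd, ?_, ?_⟩,
    fun z hz => piecewise_eq_of_mem _ _ _ hz, ?_⟩
  · intro φ hφ hc hs
    obtain ⟨i, e⟩ := split G₁ b₁ φ (1, 0) hH₁ hφ hc hs
    obtain ⟨φ', hφ', hc', hs', e1, e2⟩ := exists_cutoff_test hts hhk hφ hc hs
    rw [e, below G₁ φ φ' _ e1 e2, hU.integral_fst_below hφ' hc' hs' t,
      integral_test_above_fst hGk hg.memLp hw2 hg.memLp_fst
        (fun α h1 h2 h3 => hg.integral_eq_zero hh ht h1 h2 h3) hwα hφ hc hs i, add_zero]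
  · intro φ hφ hc hs
    obtain ⟨i, e⟩ := split G₂ b₂ φ (0, 1) hH₂ hφ hc hs
    obtain ⟨φ', hφ', hc', hs', e1, e2⟩ := exists_cutoff_test hts hhk hφ hc hs
    rw [e, below G₂ φ φ' _ e1 e2, hg.integral_snd φ' hφ' hc' hs', integral_test_above_snd hφ hc i]
    simp only [fun x : ℝ => e1 (x, t) le_rfl]
    exact add_neg_cancel _
  · refine (setLIntegral_le_lintegral _ _).trans ?_
    rw [← lintegral_add_compl _ hSm]
    refine add_le_add (le_of_eq (setLIntegral_congr_fun hSm fun z hz => ?_)) ?_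
    · simp only [piecewise_eq_of_mem _ _ _ hz]
    · set E : ℝ → ℝ≥0∞ := fun x => ‖f x‖ₑ ^ 2 + ENNReal.ofReal ((1 / Λ) ^ 2) * ‖w x‖ₑ ^ 2 with hE
      have hEm : Measurable E :=
        (hfm.enorm.pow_const 2).add ((hwm.enorm.pow_const 2).const_mul _)
      have esq : ∀ r : ℝ, ‖r‖ₑ ^ 2 = ENNReal.ofReal (r ^ 2) := fun r => by
        rw [← ofReal_norm, ← ENNReal.ofReal_pow (norm_nonneg _), Real.norm_eq_abs, sq_abs]
      have h1 : ∀ z ∈ Sᶜ, ENNReal.ofReal (S.piecewise G₁ (Ω.indicator b₁) z ^ 2 +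
          S.piecewise G₂ (Ω.indicator b₂) z ^ 2) ≤ E z.1 * ENNReal.ofReal (decay Λ t z.2 ^ 2) := by
        intro z hz
        rw [piecewise_eq_of_notMem _ _ _ hz, piecewise_eq_of_notMem _ _ _ hz]
        by_cases hzΩ : z ∈ Ω
        · rw [indicator_of_mem hzΩ, indicator_of_mem hzΩ, hE]
          simp only [esq]
          rw [← ENNReal.ofReal_mul (by positivity), ← ENNReal.ofReal_add (by positivity)
            (by positivity), ← ENNReal.ofReal_mul (by positivity)]
          refine ENNReal.ofReal_le_ofReal (le_of_eq ?_)
          simp only [hb₁, hb₂]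
          ring
        · rw [indicator_of_notMem hzΩ, indicator_of_notMem hzΩ]
          simp
      refine (setLIntegral_mono' hSm.compl h1).trans ?_
      rw [hSc, restrict_preimage_snd, lintegral_prod_mul hEm.aemeasurable
        (hdm.pow_const 2).ennreal_ofReal.aemeasurable, lintegral_decay_sq hΛ t, hE,
        lintegral_add_left (hfm.enorm.pow_const 2), lintegral_const_mul' _ _ ENNReal.ofReal_ne_top]
      -- The decay length is chosen equal to the length bound, so the Poincaré constant `Λ²` cancels
      -- the `Λ⁻²` from `∂ᵧ`. Two equal bounds times `∫ decay² = Λ / 2` give the factor `Λ`.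
      have h2 : ENNReal.ofReal ((1 / Λ) ^ 2) * ∫⁻ x, ‖w x‖ₑ ^ 2 ≤ ∫⁻ x, ‖f x‖ₑ ^ 2 := by
        refine (mul_le_mul_right hwE _).trans (le_of_eq ?_)
        rw [← mul_assoc, ← ENNReal.ofReal_mul (by positivity), ← mul_pow, one_div,
          inv_mul_cancel₀ hΛ.ne']
        simp
      calc ((∫⁻ x, ‖f x‖ₑ ^ 2) + ENNReal.ofReal ((1 / Λ) ^ 2) * ∫⁻ x, ‖w x‖ₑ ^ 2) *
            ENNReal.ofReal (Λ / 2)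
          ≤ ((∫⁻ x, ‖f x‖ₑ ^ 2) + ∫⁻ x, ‖f x‖ₑ ^ 2) * ENNReal.ofReal (Λ / 2) := by gcongr
        _ = ENNReal.ofReal Λ * ∫⁻ x, ‖f x‖ₑ ^ 2 := by
            rw [← two_mul, mul_right_comm, ← ENNReal.ofReal_ofNat 2,
              ← ENNReal.ofReal_mul (by norm_num)]
            congr 2
            ring

/-! ### Exponential decay of the elastic energy of a minimizer -/

/-- Only heights below `δ` enter the averages defining the trace, and eventually `δ < t`. -/
theorem hasMisfitTrace_of_eq_below {h k : ℝ → ℝ} {u u' : ℝ × ℝ → ℝ} {t : ℝ} (ht : 0 < t)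
    (hu : ∀ z, z.2 < t → u' z = u z) (hhk : ∀ x, 0 < k x → 0 < h x) (h0 : HasMisfitTrace h u) :
    HasMisfitTrace k u' := by
  filter_upwards [h0] with x hx hkx
  refine (hx (hhk x hkx)).congr' ?_
  filter_upwards [Ioo_mem_nhdsGT ht] with δ hδ
  congr 1
  refine intervalIntegral.integral_congr fun y hy => ?_
  rw [uIcc_of_le hδ.1.le] at hy
  simp only [hu (x, y) (hy.2.trans_lt hδ.2)]

theorem lintegral_sq_add_sq_ne_top {G₁ G₂ : ℝ × ℝ → ℝ} (h₁ : MemLp G₁ 2 volume)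
    (h₂ : MemLp G₂ 2 volume) : ∫⁻ z, ENNReal.ofReal (G₁ z ^ 2 + G₂ z ^ 2) ≠ ⊤ := by
  have hi : Integrable (fun z => G₁ z ^ 2 + G₂ z ^ 2) := h₁.integrable_sq.add h₂.integrable_sq
  rw [← ofReal_integral_eq_lintegral_ofReal hi (Eventually.of_forall fun z => by positivity)]
  exact ENNReal.ofReal_ne_top

theorem dirichletEnergy_eq_lintegral {Ω : Set (ℝ × ℝ)} (hΩ : IsOpen Ω) {u U G₁ G₂ : ℝ × ℝ → ℝ}
    (h : PlaneSobolev Ω U G₁ G₂) (hu : u =ᵐ[volume.restrict Ω] U) :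
    dirichletEnergy Ω u = ∫⁻ z, ENNReal.ofReal (G₁ z ^ 2 + G₂ z ^ 2) := by
  rw [dirichletEnergy_eq hΩ (h.isWeakGradient hu)]
  refine setLIntegral_eq_of_support_subset ?_
  intro z hz
  by_contra hzΩ
  refine hz ?_
  simp [h.zero_fst z hzΩ, h.zero_snd z hzΩ]

/-- The minimizer is compared with the pair from `exists_competitor`; the bulk energy below `t`
occurs on both sides and is finite, hence cancels. -/
theorem IsEnergyMinimizer.energy_above_le {V : ℝ} {u : ℝ × ℝ → ℝ} {h : ℝ → ℝ}
    (hmin : IsEnergyMinimizer V u h) {k : ℝ → ℝ} (hk : MemH1Line k) (hk0 : ∀ x, 0 ≤ k x)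
    (hki : Integrable k) (hkV : ∫ x, k x = V) {s t Λ : ℝ} (ht : 0 < t) (hts : t < s) (hΛ : 0 < Λ)
    (hhk : ∀ x, k x = h x ∨ (s ≤ h x ∧ s ≤ k x))
    (hvol : volume {x | t < h x} ≤ ENNReal.ofReal Λ) {U G₁ G₂ : ℝ × ℝ → ℝ}
    (hU : PlaneSobolev (filmDomain h) U G₁ G₂) (huU : u =ᵐ[volume.restrict (filmDomain h)] U)
    (hg : GoodSlice (filmDomain h) U G₁ G₂ t) :
    (∫⁻ z in {z : ℝ × ℝ | z.2 ∈ Ici t}, ENNReal.ofReal (G₁ z ^ 2 + G₂ z ^ 2)) + surfaceEnergy h ≤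
      ENNReal.ofReal Λ * (∫⁻ x, ‖G₁ (x, t)‖ₑ ^ 2) + surfaceEnergy k := by
  classical
  have hh := hmin.1.profile_memH1.continuous
  have hkc := hk.continuous
  obtain ⟨M, hM⟩ := hk.exists_le hk0 hki
  obtain ⟨U', H₁, H₂, hU', hUU', hE⟩ :=
    exists_competitor hh hkc hM ht hts hΛ hhk hvol hU hg
  set S : Set (ℝ × ℝ) := {z | z.2 < t} with hS
  have hSm : MeasurableSet S := measurableSet_lt measurable_snd measurable_const
  have hSc : Sᶜ = {z : ℝ × ℝ | z.2 ∈ Ici t} := by ext z; simp [hS]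
  -- Below `t` the original `u` is kept rather than its representative `U`, so that the trace
  -- condition carries over directly.
  set u' : ℝ × ℝ → ℝ := S.piecewise u U' with hu'
  have hu'U : u' =ᵐ[volume.restrict (filmDomain k)] U' := by
    rw [EventuallyEq, ae_restrict_iff' (isOpen_filmDomain hh).measurableSet] at huU
    rw [EventuallyEq, ae_restrict_iff' (isOpen_filmDomain hkc).measurableSet]
    filter_upwards [huU] with z hz hzk
    by_cases hzS : z ∈ S
    · rw [hu', piecewise_eq_of_mem _ _ _ hzS, hUU' z hzS]
      refine hz ⟨hzk.1, ?_⟩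
      rcases hhk z.1 with he | he
      · rw [← he]; exact hzk.2
      · have : z.2 < t := hzS
        linarith [he.1]
    · rw [hu', piecewise_eq_of_notMem _ _ _ hzS]
  have hadm : Admissible V u' k := by
    refine ⟨hk, hk0, hki, hkV, ⟨(memLp_congr_ae hu'U).2 (hU'.memLp.restrict _), _,
      hU'.isWeakGradient hu'U⟩, hasMisfitTrace_of_eq_below ht
      (fun z hz => piecewise_eq_of_mem _ _ _ hz) (fun x hx => ?_) hmin.1.trace⟩
    rcases hhk x with he | he
    · rwa [← he]
    · linarith [he.1]
  have hle : totalEnergy u h ≤ totalEnergy u' k := by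
    rw [hmin.2]
    exact iInf₂_le_of_le u' k (iInf_le _ hadm)
  unfold totalEnergy at hle
  rw [dirichletEnergy_eq_lintegral (isOpen_filmDomain hh) hU huU,
    dirichletEnergy_eq (isOpen_filmDomain hkc) (hU'.isWeakGradient hu'U),
    ← lintegral_add_compl _ hSm, hSc, add_assoc] at hle
  have hfin : ∫⁻ z in S, ENNReal.ofReal (G₁ z ^ 2 + G₂ z ^ 2) ≠ ⊤ :=
    ((setLIntegral_le_lintegral _ _).trans_lt
      (lintegral_sq_add_sq_ne_top hU.memLp_fst hU.memLp_snd).lt_top).ne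
  refine (ENNReal.add_le_add_iff_left hfin).1 (hle.trans ?_)
  rw [← add_assoc]
  gcongr

/-- A discrete Grönwall inequality, in the limit of small steps. -/
theorem mul_exp_le_of_step {Z : ℝ → ℝ≥0∞} {Λ a b : ℝ} (hab : a < b)
    (hZ : ∀ t₁ t₂, a ≤ t₁ → t₁ < t₂ → t₂ ≤ b →
      Z t₂ * ENNReal.ofReal (1 + (t₂ - t₁) / Λ) ≤ Z t₁) (hΛ : 0 < Λ) :
    Z b * ENNReal.ofReal (Real.exp ((b - a) / Λ)) ≤ Z a := by
  -- Divide `[a, b]` into `n` equal steps, each gaining the factor `1 + (b - a) / (nΛ)`; the product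
  -- tends to the exponential.
  have hstep : ∀ n : ℕ, 0 < n →
      Z b * ENNReal.ofReal ((1 + (b - a) / Λ / n) ^ n) ≤ Z a := by
    intro n hn
    have hn' : (0 : ℝ) < n := Nat.cast_pos.2 hn
    set q := (b - a) / n with hq
    have hq0 : 0 < q := div_pos (by linarith) hn'
    have hqn : q * n = b - a := by rw [hq]; field_simp
    have hr : (b - a) / Λ / n = q / Λ := by rw [hq]; field_simp
    have h1 : ∀ j : ℕ, j ≤ n → Z (a + q * j) * ENNReal.ofReal ((1 + q / Λ) ^ j) ≤ Z a := by
      intro j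
      induction j with
      | zero => simp
      | succ j ih =>
        intro hj
        have hj' : ((j : ℝ) + 1) ≤ n := by exact_mod_cast hj
        have hq1 : q * (j + 1) ≤ q * n := mul_le_mul_of_nonneg_left hj' hq0.le
        have h2 := hZ (a + q * j) (a + q * (j + 1 : ℕ)) (le_add_of_nonneg_right (by positivity))
          (by push_cast; linarith) (by push_cast; linarith)
        rw [show a + q * (j + 1 : ℕ) - (a + q * j) = q by push_cast; ring] at h2
        refine le_trans ?_ (ih (by omega))
        rw [pow_succ', ENNReal.ofReal_mul (by positivity), ← mul_assoc]
        gcongr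
    have h3 := h1 n le_rfl
    rw [hqn, add_sub_cancel] at h3
    rwa [hr]
  have hl : Tendsto (fun n : ℕ => Z b * ENNReal.ofReal ((1 + (b - a) / Λ / n) ^ n)) atTop
      (𝓝 (Z b * ENNReal.ofReal (Real.exp ((b - a) / Λ)))) :=
    ENNReal.Tendsto.const_mul (ENNReal.tendsto_ofReal (Real.tendsto_one_add_div_pow_exp _))
      (Or.inl (by simpa using Real.exp_pos _))
  refine le_of_tendsto hl ?_
  filter_upwards [eventually_gt_atTop 0] with n hn using hstep n hn

/-- Integrated form of `∫ |∂ₓu(x, t)|² dx ≤ -E'(t)`: Fubini on the strip, with the vertical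
derivative discarded. -/
theorem lintegral_above_add_le {G₁ G₂ : ℝ × ℝ → ℝ} (h₁ : Measurable G₁) {a b : ℝ} (hab : a ≤ b) :
    (∫⁻ z in {z : ℝ × ℝ | z.2 ∈ Ici b}, ENNReal.ofReal (G₁ z ^ 2 + G₂ z ^ 2)) +
      ∫⁻ t in Ico a b, ∫⁻ x, ‖G₁ (x, t)‖ₑ ^ 2 ≤
      ∫⁻ z in {z : ℝ × ℝ | z.2 ∈ Ici a}, ENNReal.ofReal (G₁ z ^ 2 + G₂ z ^ 2) := by
  have e : ∫⁻ t in Ico a b, ∫⁻ x, ‖G₁ (x, t)‖ₑ ^ 2 =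
      ∫⁻ z in {z : ℝ × ℝ | z.2 ∈ Ico a b}, ‖G₁ z‖ₑ ^ 2 := by
    rw [restrict_preimage_snd, lintegral_prod_symm _ (h₁.enorm.pow_const 2).aemeasurable]
  have hu : {z : ℝ × ℝ | z.2 ∈ Ici a} = {z | z.2 ∈ Ici b} ∪ {z | z.2 ∈ Ico a b} := by
    ext z
    simp only [mem_ofPred_eq, mem_union, mem_Ici, mem_Ico]
    constructor
    · intro h
      rcases le_or_gt b z.2 with h' | h'
      · exact Or.inl h'
      · exact Or.inr ⟨h, h'⟩
    · rintro (h | h)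
      · exact hab.trans h
      · exact h.1
  have hm : MeasurableSet {z : ℝ × ℝ | z.2 ∈ Ico a b} := measurable_snd measurableSet_Ico
  rw [e, hu, lintegral_union hm]
  · gcongr with z
    rw [← ofReal_norm, ← ENNReal.ofReal_pow (norm_nonneg _), Real.norm_eq_abs, sq_abs]
    exact ENNReal.ofReal_le_ofReal (le_add_of_nonneg_right (sq_nonneg _))
  · rw [Set.disjoint_left]
    intro z (h : b ≤ z.2) (h' : z.2 ∈ Ico a b)
    exact not_lt.2 h h'.2

/-- The profile of a minimizer minimizes the surface energy above a given height up to an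
exponentially small error. -/
theorem IsEnergyMinimizer.excess_le {V : ℝ} (hV : 0 < V) {u : ℝ × ℝ → ℝ} {h : ℝ → ℝ}
    (hmin : IsEnergyMinimizer V u h) {k : ℝ → ℝ} (hk : MemH1Line k) (hk0 : ∀ x, 0 ≤ k x)
    (hki : Integrable k) (hkV : ∫ x, k x = V) {s : ℝ} (hs : 0 < s)
    (hhk : ∀ x, k x = h x ∨ (s ≤ h x ∧ s ≤ k x)) {X : ℝ≥0∞}
    (hX : surfaceEnergy h = surfaceEnergy k + X) :
    X * ENNReal.ofReal (Real.exp (s ^ 2 / (4 * V))) ≤ minEnergy V := by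
  have hh := hmin.1.profile_memH1.continuous
  have hΩ := isOpen_filmDomain hh
  obtain ⟨hu2, g, hg⟩ := hmin.1.memH1
  obtain ⟨U, G₁, G₂, hU, huU, -, -⟩ := hg.exists_planeSobolev hΩ.measurableSet hu2
  -- For heights `t ≥ s / 2` Markov's inequality bounds the length of `{h > t}` by `V / t ≤ 2V / s`.
  set Λ : ℝ := 2 * V / s with hΛdef
  have hΛ : 0 < Λ := by positivity
  set E : ℝ → ℝ≥0∞ := fun t =>
    ∫⁻ z in {z : ℝ × ℝ | z.2 ∈ Ici t}, ENNReal.ofReal (G₁ z ^ 2 + G₂ z ^ 2) with hE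
  set D : ℝ → ℝ≥0∞ := fun t => ∫⁻ x, ‖G₁ (x, t)‖ₑ ^ 2 with hD
  have hanti : ∀ t₁ t₂, t₁ ≤ t₂ → E t₂ ≤ E t₁ := fun t₁ t₂ h12 =>
    lintegral_mono_set fun z (hz : t₂ ≤ z.2) => h12.trans hz
  have key : ∀ᵐ t : ℝ, s / 2 ≤ t → t < s → E t + X ≤ ENNReal.ofReal Λ * D t := by
    filter_upwards [hU.ae_goodSlice hΩ] with t hgt h1 h2
    have ht : 0 < t := by linarith
    have hvol : volume {x | t < h x} ≤ ENNReal.ofReal Λ := by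
      refine (volume_superlevel_le hmin.1.profile_nonneg hmin.1.profile_integrable ht).trans
        (ENNReal.ofReal_le_ofReal ?_)
      rw [hmin.1.profile_volume, hΛdef, div_le_div_iff₀ ht hs]
      nlinarith
    have h3 := hmin.energy_above_le hk hk0 hki hkV ht h2 hΛ hhk hvol hU huU hgt
    rw [hX, add_comm (surfaceEnergy k), ← add_assoc] at h3
    exact (ENNReal.add_le_add_iff_right (surfaceEnergy_ne_top hk)).1 h3
  -- Integrate `key` over `[t₁, t₂)`, bounding `E t` below by `E t₂`. The constant `X` is carried
  -- along and so receives the same exponential factor as the elastic energy.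
  have step : ∀ t₁ t₂, s / 2 ≤ t₁ → t₁ < t₂ → t₂ ≤ s →
      (E t₂ + X) * ENNReal.ofReal (1 + (t₂ - t₁) / Λ) ≤ E t₁ + X := by
    intro t₁ t₂ h1 h12 h2
    have h3 : ∫⁻ t in Ico t₁ t₂, (ENNReal.ofReal Λ)⁻¹ * (E t₂ + X) ≤ ∫⁻ t in Ico t₁ t₂, D t := by
      refine lintegral_mono_ae ?_
      filter_upwards [ae_restrict_of_ae key, ae_restrict_mem measurableSet_Ico] with t hkey ht
      rw [mul_comm, ← div_eq_mul_inv]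
      refine ENNReal.div_le_of_le_mul ?_
      rw [mul_comm]
      refine le_trans ?_ (hkey (h1.trans ht.1) (ht.2.trans_le h2))
      gcongr
      exact hanti _ _ ht.2.le
    rw [setLIntegral_const, Real.volume_Ico] at h3
    have h4 := lintegral_above_add_le (G₂ := G₂) hU.meas_fst h12.le
    calc (E t₂ + X) * ENNReal.ofReal (1 + (t₂ - t₁) / Λ)
        = E t₂ + X + (ENNReal.ofReal Λ)⁻¹ * (E t₂ + X) * ENNReal.ofReal (t₂ - t₁) := by
          rw [ENNReal.ofReal_add zero_le_one (div_nonneg (by linarith) hΛ.le),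
            ENNReal.ofReal_div_of_pos hΛ, ENNReal.ofReal_one, div_eq_mul_inv]
          ring
      _ ≤ E t₂ + X + ∫⁻ t in Ico t₁ t₂, D t := by gcongr
      _ = (E t₂ + ∫⁻ t in Ico t₁ t₂, D t) + X := by ring
      _ ≤ E t₁ + X := by gcongr
  have hfin := mul_exp_le_of_step (Z := fun t => E t + X) (a := s / 2) (b := s) (by linarith)
    step hΛ
  have hexp : (s - s / 2) / Λ = s ^ 2 / (4 * V) := by
    rw [hΛdef]; field_simp; ring
  rw [hexp] at hfin
  calc X * ENNReal.ofReal (Real.exp (s ^ 2 / (4 * V)))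
      ≤ (E s + X) * ENNReal.ofReal (Real.exp (s ^ 2 / (4 * V))) := by
        gcongr; exact le_add_self
    _ ≤ E (s / 2) + X := hfin
    _ ≤ dirichletEnergy (filmDomain h) u + surfaceEnergy h := by
        rw [dirichletEnergy_eq_lintegral hΩ hU huU, hX]
        exact add_le_add (setLIntegral_le_lintegral _ _) le_add_self
    _ = minEnergy V := hmin.2

/-! ### An upper bound for the minimal energy -/

theorem memH1Line_of_contDiff {η : ℝ → ℝ} (hη : ContDiff ℝ ∞ η) (hc : HasCompactSupport η) :
    MemH1Line η :=
  ⟨hη.continuous.memLp_of_hasCompactSupport hc,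
    fun _ _ => (hη.of_le (by simp)).contDiffOn.absolutelyContinuousOnInterval,
    (hη.continuous_deriv (by simp)).memLp_of_hasCompactSupport hc.deriv⟩

theorem isWeakGradient_fst {Ω : Set (ℝ × ℝ)} (hv : volume Ω ≠ ⊤) :
    IsWeakGradient Ω Prod.fst fun _ => (1, 0) := by
  have hfin : IsFiniteMeasure (volume.restrict Ω) := ⟨by simpa using hv.lt_top⟩
  have key : ∀ (φ : ℝ × ℝ → ℝ) (v : ℝ × ℝ), ContDiff ℝ ∞ φ → HasCompactSupport φ →
      tsupport φ ⊆ Ω → ∫ z in Ω, z.1 * fderiv ℝ φ z v = -∫ z in Ω, v.1 * φ z := by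
    intro φ v hφ hc hs
    rw [setIntegral_eq_integral_of_forall_compl_eq_zero,
      setIntegral_eq_integral_of_forall_compl_eq_zero]
    · have hφd : Continuous fun z => fderiv ℝ φ z v :=
        (hφ.continuous_fderiv (by simp)).clm_apply continuous_const
      have hφc : HasCompactSupport fun z => fderiv ℝ φ z v := hc.fderiv_apply (𝕜 := ℝ) v
      have hd : ∀ z : ℝ × ℝ, fderiv ℝ (Prod.fst : ℝ × ℝ → ℝ) z v = v.1 := fun z => by
        rw [fderiv_fst]; rfl
      have := integral_mul_fderiv_eq_neg_fderiv_mul_of_integrable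
        (μ := (volume : Measure (ℝ × ℝ))) (f := Prod.fst) (g := φ) (v := v) ?_ ?_ ?_
        (fun _ _ => differentiableAt_fst) (fun z _ => hφ.differentiable (by simp) z)
      · simpa only [hd] using this
      · simp only [hd]
        exact (hφ.continuous.integrable_of_hasCompactSupport hc).const_mul _
      · exact (continuous_fst.mul hφd).integrable_of_hasCompactSupport hφc.mul_left
      · exact (continuous_fst.mul hφ.continuous).integrable_of_hasCompactSupport hc.mul_left
    · intro z hz
      rw [image_eq_zero_of_notMem_tsupport fun h => hz (hs h), mul_zero]
    · intro z hz
      rw [fderiv_eq_zero_of_notMem_tsupport fun h => hz (hs h)]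
      simp
  refine ⟨memLp_const _, memLp_const _, fun φ hφ hc hs => ?_, fun φ hφ hc hs => ?_⟩
  · simpa using key φ (1, 0) hφ hc hs
  · simpa using key φ (0, 1) hφ hc hs

theorem volume_filmDomain {h : ℝ → ℝ} (hh : Continuous h) (h0 : ∀ x, 0 ≤ h x)
    (hi : Integrable h) : volume (filmDomain h) = ENNReal.ofReal (∫ x, h x) := by
  have e : filmDomain h = regionBetween (fun _ => 0) h univ := by
    ext z; simp [filmDomain, regionBetween]
  rw [e, Measure.volume_eq_prod, volume_regionBetween_eq_lintegral measurable_const.aemeasurable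
    hh.measurable.aemeasurable MeasurableSet.univ, Measure.restrict_univ,
    ofReal_integral_eq_lintegral_ofReal hi (Eventually.of_forall h0)]
  simp

/-- For `u(x, y) = x` the Dirichlet energy is the area of the film. Compact support of `h` bounds
`x` on the film, so that `u` is square integrable. -/
theorem minEnergy_integral_le {h : ℝ → ℝ} (hh : MemH1Line h) (h0 : ∀ x, 0 ≤ h x)
    (hc : HasCompactSupport h) :
    minEnergy (∫ x, h x) ≤ ENNReal.ofReal (∫ x, h x) + surfaceEnergy h := by
  have hi : Integrable h := hh.continuous.integrable_of_hasCompactSupport hc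
  have hvol := volume_filmDomain hh.continuous h0 hi
  have hv : volume (filmDomain h) ≠ ⊤ := by rw [hvol]; exact ENNReal.ofReal_ne_top
  have hfin : IsFiniteMeasure (volume.restrict (filmDomain h)) := ⟨by simpa using hv.lt_top⟩
  have hΩm := (isOpen_filmDomain hh.continuous).measurableSet
  have hg := isWeakGradient_fst hv
  obtain ⟨R, hR⟩ := hc.isBounded.exists_norm_le
  have hL : MemLp (Prod.fst : ℝ × ℝ → ℝ) 2 (volume.restrict (filmDomain h)) := by
    refine MemLp.of_bound continuous_fst.aestronglyMeasurable R ?_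
    filter_upwards [ae_restrict_mem hΩm] with z hz
    refine hR _ (subset_tsupport _ ?_)
    exact (hz.1.trans hz.2).ne'
  have hadm : Admissible (∫ x, h x) Prod.fst h := by
    refine ⟨hh, h0, hi, rfl, ⟨hL, _, hg⟩, Eventually.of_forall fun x _ => ?_⟩
    simp
  refine (iInf₂_le_of_le Prod.fst h (iInf_le _ hadm)).trans ?_
  refine add_le_add ((iInf₂_le _ hg).trans (le_of_eq ?_)) le_rfl
  simp [hvol]

/-- The profiles `T² η(x / T)`, with `∫ η = 1`, have volume `T³` and surface energy `T³ S(η)`, so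
both energies are linear in the volume. -/
theorem exists_minEnergy_le :
    ∃ C : ℝ, 0 < C ∧ ∀ T : ℝ, 0 < T → minEnergy (T ^ 3) ≤ ENNReal.ofReal (C * T ^ 3) := by
  let b : ContDiffBump (0 : ℝ) := ⟨1, 2, one_pos, one_lt_two⟩
  set η : ℝ → ℝ := b.normed volume with hη
  have hηc : HasCompactSupport η := b.hasCompactSupport_normed
  have hη1 : MemH1Line η := memH1Line_of_contDiff b.contDiff_normed hηc
  have htop := surfaceEnergy_ne_top hη1
  refine ⟨1 + (surfaceEnergy η).toReal, by positivity, fun T hT => ?_⟩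
  have hTi : 0 < T⁻¹ := inv_pos.2 hT
  have h1 := minEnergy_integral_le (hη1.scale (T ^ 2) hTi)
    (fun x => mul_nonneg (by positivity) (b.nonneg_normed _))
    ((hηc.comp_homeomorph (Homeomorph.mulLeft₀ T⁻¹ hTi.ne')).mul_left (f := fun _ => T ^ 2))
  rw [integral_scale η _ hTi, surfaceEnergy_scale η _ hTi, hη, b.integral_normed, ← hη] at h1
  have e1 : T ^ 2 * T⁻¹⁻¹ * 1 = T ^ 3 := by rw [inv_inv]; ring
  have e2 : (T ^ 2) ^ 2 * T⁻¹ = T ^ 3 := by field_simp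
  rw [e1, e2] at h1
  refine h1.trans (le_of_eq ?_)
  rw [add_mul, one_mul, ENNReal.ofReal_add (by positivity) (by positivity), mul_comm,
    ENNReal.ofReal_mul (by positivity), ENNReal.ofReal_toReal htop, mul_comm]

/-! ### The estimate on the rescaled profile -/

/-- Writing `V = T⁵` turns the fractional powers of the rescaling into integer ones. -/
theorem rescaledProfile_pow {T : ℝ} (hT : 0 < T) (h : ℝ → ℝ) :
    rescaledProfile (T ^ 5) h = fun x => (T ^ 3)⁻¹ * h (T ^ 2 * x) := by
  have e1 : (T ^ 5) ^ (-(3 / 5) : ℝ) = (T ^ 3)⁻¹ := by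
    rw [← Real.rpow_natCast T 5, ← Real.rpow_mul hT.le, ← Real.rpow_natCast T 3,
      ← Real.rpow_neg hT.le]
    norm_num
  have e2 : (T ^ 5) ^ (2 / 5 : ℝ) = T ^ 2 := by
    rw [← Real.rpow_natCast T 5, ← Real.rpow_mul hT.le, ← Real.rpow_natCast T 2]
    norm_num
  funext x
  rw [rescaledProfile, e1, e2]

theorem criticalVolume_nonneg : 0 ≤ criticalVolume :=
  Real.sSup_nonneg fun _ h => h.1.le

/-- The excess of surface energy on an interval, in rescaled variables. -/
theorem IsEnergyMinimizer.rescaled_excess_le {C : ℝ}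
    (hC : ∀ T : ℝ, 0 < T → minEnergy (T ^ 3) ≤ ENNReal.ofReal (C * T ^ 3)) {T : ℝ} (hT : 0 < T)
    {u : ℝ × ℝ → ℝ} {h : ℝ → ℝ} (hmin : IsEnergyMinimizer (T ^ 5) u h) {s : ℝ} (hs : 0 < s)
    {f k : ℝ → ℝ} (hf : f = fun x => (T ^ 3)⁻¹ * h (T ^ 2 * x)) (hk : MemH1Line k)
    (hki : Integrable k) (hkf : ∫ x, k x = ∫ x, f x)
    (hfk : ∀ x, k x = f x ∨ (s ≤ f x ∧ s ≤ k x)) {D : ℝ≥0∞}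
    (hD : surfaceEnergy f = surfaceEnergy k + D) :
    D ≤ ENNReal.ofReal (C * T * Real.exp (-(s ^ 2 * T / 4))) := by
  have hB : 0 < (T ^ 2)⁻¹ := by positivity
  have hh : h = fun x => T ^ 3 * f ((T ^ 2)⁻¹ * x) := by
    funext x
    rw [hf]
    simp only
    rw [← mul_assoc, ← mul_assoc, mul_inv_cancel₀ (by positivity), one_mul,
      mul_inv_cancel₀ (by positivity), one_mul]
  have hf0 : ∀ x, 0 ≤ f x := fun x => by
    rw [hf]; exact mul_nonneg (by positivity) (hmin.1.profile_nonneg _)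
  have hSh : surfaceEnergy h = ENNReal.ofReal (T ^ 4) * surfaceEnergy f := by
    conv_lhs => rw [hh]
    rw [surfaceEnergy_scale _ _ hB]
    congr 2
    field_simp
  have hSk : surfaceEnergy (fun x => T ^ 3 * k ((T ^ 2)⁻¹ * x)) =
      ENNReal.ofReal (T ^ 4) * surfaceEnergy k := by
    rw [surfaceEnergy_scale _ _ hB]
    congr 2
    field_simp
  have hint : ∫ x, T ^ 3 * k ((T ^ 2)⁻¹ * x) = T ^ 5 := by
    rw [integral_scale _ _ hB, hkf, ← integral_scale _ _ hB, ← hmin.1.profile_volume]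
    conv_rhs => rw [hh]
  -- Undoing the rescaling multiplies heights by `T³` and surface energies by `T⁶ · T⁻² = T⁴`, hence
  -- the level `T³ s` and the excess `T⁴ D`.
  have h1 := hmin.excess_le (by positivity) (hk.scale (T ^ 3) hB)
    (fun x => mul_nonneg (by positivity) ?_) (integrable_scale hki _ hB) hint
    (s := T ^ 3 * s) (by positivity) (fun x => ?_)
    (X := ENNReal.ofReal (T ^ 4) * D) (by rw [hSh, hSk, hD, mul_add])
  · have e : (T ^ 3 * s) ^ 2 / (4 * T ^ 5) = s ^ 2 * T / 4 := by field_simp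
    -- The energy bound is parametrized by the cube root of the volume, which is `T⁵` here.
    have h2 := hC (T ^ (5 / 3 : ℝ)) (by positivity)
    have e3 : (T ^ (5 / 3 : ℝ)) ^ 3 = T ^ 5 := by
      rw [← Real.rpow_natCast, ← Real.rpow_mul hT.le, ← Real.rpow_natCast]
      norm_num
    rw [e3] at h2
    rw [e] at h1
    have h3 := h1.trans h2
    have hpos : 0 < T ^ 4 * Real.exp (s ^ 2 * T / 4) := by positivity
    rw [mul_right_comm, ← ENNReal.ofReal_mul (by positivity), mul_comm] at h3
    rw [← ENNReal.le_div_iff_mul_le (Or.inl (by simpa using hpos))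
      (Or.inl ENNReal.ofReal_ne_top), ← ENNReal.ofReal_div_of_pos hpos] at h3
    refine h3.trans (ENNReal.ofReal_le_ofReal (le_of_eq ?_))
    rw [Real.exp_neg]
    field_simp
  · rcases hfk ((T ^ 2)⁻¹ * x) with he | he
    · rw [he]; exact hf0 _
    · exact hs.le.trans he.2
  · rcases hfk ((T ^ 2)⁻¹ * x) with he | he
    · left
      rw [he]
      conv_rhs => rw [hh]
    · right
      refine ⟨?_, mul_le_mul_of_nonneg_left he.2 (by positivity)⟩
      conv_rhs => rw [hh]
      exact mul_le_mul_of_nonneg_left he.1 (by positivity)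

theorem integrable_and_integral_eq_of_competitor {f k : ℝ → ℝ} {a b : ℝ} (hf : Integrable f)
    (hk : IsCompetitorOn f (Ioo a b) k) (hkf : ∀ x ∉ Ioo a b, k x = f x) :
    Integrable k ∧ ∫ x, k x = ∫ x, f x := by
  have h1 : IntegrableOn k (Ioo a b) :=
    (hk.memH1.continuous.integrableOn_Icc (a := a) (b := b)).mono_set Ioo_subset_Icc_self
  have h2 : IntegrableOn k (Ioo a b)ᶜ :=
    hf.integrableOn.congr_fun (fun x hx => (hkf x hx).symm) measurableSet_Ioo.compl
  have hki : Integrable k := by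
    rw [← integrableOn_univ, ← union_compl_self (Ioo a b)]
    exact h1.union h2
  refine ⟨hki, ?_⟩
  rw [← integral_add_compl measurableSet_Ioo hki, ← integral_add_compl measurableSet_Ioo hf,
    hk.integral_eq, setIntegral_congr_fun measurableSet_Ioo.compl fun x hx => hkf x hx]

/-- Half of the exponential absorbs the linear factor, by `1 + y ≤ exp y` with `y = c x / 2`. -/
theorem mul_exp_neg_le {c x : ℝ} (hc : 0 < c) :
    x * Real.exp (-(c * x)) ≤ 2 / c * Real.exp (-(c * x / 2)) := by
  have h1 : x ≤ 2 / c * Real.exp (c * x / 2) := by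
    have := Real.add_one_le_exp (c * x / 2)
    rw [div_mul_eq_mul_div, le_div_iff₀ hc]
    linarith
  calc x * Real.exp (-(c * x)) ≤ 2 / c * Real.exp (c * x / 2) * Real.exp (-(c * x)) := by gcongr
    _ = 2 / c * Real.exp (-(c * x / 2)) := by
      rw [mul_assoc, ← Real.exp_add]
      congr 2
      ring

theorem eLpNorm_two_le_of_lintegral_le {α : Type*} [MeasurableSpace α] {μ : Measure α}
    {F : α → ℝ} {r : ℝ} (hr : 0 ≤ r) (h : ∫⁻ x, ‖F x‖ₑ ^ 2 ∂μ ≤ ENNReal.ofReal (r ^ 2)) :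
    eLpNorm F 2 μ ≤ ENNReal.ofReal r := by
  rw [eLpNorm_eq_lintegral_rpow_enorm_toReal (by norm_num) (by norm_num)]
  simp only [ENNReal.toReal_ofNat, ENNReal.rpow_ofNat]
  rw [one_div, ENNReal.rpow_inv_le_iff (by norm_num), ENNReal.rpow_ofNat,
    ← ENNReal.ofReal_pow hr]
  exact h

end Epitaxy

theorem mainTheorem7 (ε : ℝ) (hε : 0 < ε) :
    ∃ C₀ C₁ : ℝ, 0 < C₀ ∧ 0 < C₁ ∧
      ∀ V : ℝ, Epitaxy.criticalVolume < V →
      ∀ (u : ℝ × ℝ → ℝ) (h : ℝ → ℝ), Epitaxy.IsEnergyMinimizer V u h →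
      ∀ s : ℝ, ε ≤ s →
      ∀ I : Set ℝ, Epitaxy.IsLargestComponent (Epitaxy.rescaledProfile V h) s I →
        (∃ hbar : ℝ → ℝ,
          Epitaxy.IsConstrainedMinimizerOn (Epitaxy.rescaledProfile V h) I hbar) ∧
        ∀ hbar : ℝ → ℝ,
          Epitaxy.IsConstrainedMinimizerOn (Epitaxy.rescaledProfile V h) I hbar →
          eLpNorm (fun x => Epitaxy.rescaledProfile V h x - hbar x) 2 (volume.restrict I) ≤
            ENNReal.ofReal (C₀ * Real.exp (-C₁ * V ^ (1 / 5 : ℝ))) := by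
  obtain ⟨C, hC0, hC⟩ := Epitaxy.exists_minEnergy_le
  -- Square roots of the factors in `(b - a)² D ≤ ε⁻² · (8C / ε²) · exp(-ε² T / 8)`.
  refine ⟨√(8 * C) / ε ^ 2, ε ^ 2 / 16, by positivity, by positivity, ?_⟩
  intro V hV u h hmin s hs I hI
  have hV0 : 0 < V := Epitaxy.criticalVolume_nonneg.trans_lt hV
  have hs0 : 0 < s := hε.trans_le hs
  obtain ⟨T, hT, hTV, hT5⟩ : ∃ T : ℝ, 0 < T ∧ V ^ (1 / 5 : ℝ) = T ∧ V = T ^ 5 := by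
    refine ⟨V ^ (1 / 5 : ℝ), by positivity, rfl, ?_⟩
    rw [← Real.rpow_natCast, ← Real.rpow_mul hV0.le]
    norm_num
  rw [hTV]
  subst hT5
  have hfe := Epitaxy.rescaledProfile_pow hT h
  set f := Epitaxy.rescaledProfile (T ^ 5) h with hfdef
  have hB : 0 < T ^ 2 := by positivity
  have hfH : Epitaxy.MemH1Line f := by
    rw [hfe]; exact hmin.1.profile_memH1.scale _ hB
  have hf0 : ∀ x, 0 ≤ f x := fun x => by
    rw [hfe]; exact mul_nonneg (by positivity) (hmin.1.profile_nonneg _)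
  have hfi : Integrable f := by
    rw [hfe]; exact Epitaxy.integrable_scale hmin.1.profile_integrable _ hB
  have hf1 : ∫ x, f x = 1 := by
    rw [hfe, Epitaxy.integral_scale _ _ hB, hmin.1.profile_volume]
    field_simp
  obtain ⟨⟨x₀, hx₀, rfl⟩, -⟩ := hI
  obtain ⟨a, b, hab, hIab, hfa, hfb, hlen⟩ :=
    Epitaxy.component_superlevel hfH.continuous hf0 hfi hs0 hx₀
  have hfs : ∀ x ∈ Ioo a b, s ≤ f x := fun x hx => by
    rw [← hIab] at hx
    exact le_of_lt (connectedComponentIn_subset {y | s < f y} x₀ hx)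
  rw [hIab]
  obtain ⟨k, hkc, hkf, hks, hkE, hkmin⟩ := Epitaxy.exists_glued_minimizer hfH hab hfa hfb hfs
  refine ⟨⟨k, hkc, fun g hg => ?_⟩, fun hbar hbar_min => ?_⟩
  · obtain ⟨D, hD, -⟩ := hkmin g hg
    rw [hD]
    exact le_self_add
  -- The profile `f` competes with itself, so `D` is its excess over the minimizer `k`.
  · obtain ⟨D, hD, hDf⟩ := hkmin f ⟨hfH, fun _ _ => rfl, rfl⟩
    obtain ⟨D', hD', hD'b⟩ := hkmin hbar hbar_min.1
    -- Uniqueness: a minimizer has no excess over `k`, and Poincaré's inequality then forces it to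
    -- equal `k` almost everywhere on the interval.
    have hD'0 : D' = 0 := by
      have h1 := hbar_min.2 k hkc
      rw [hD'] at h1
      have h2 : Epitaxy.surfaceEnergyOn (Ioo a b) k + D' ≤
          Epitaxy.surfaceEnergyOn (Ioo a b) k + 0 := by rwa [add_zero]
      exact le_antisymm ((ENNReal.add_le_add_iff_left
        (Epitaxy.surfaceEnergyOn_ne_top hkc.memH1 _)).1 h2) zero_le
    rw [hD'0, mul_zero] at hD'b
    have hae : ∀ᵐ x ∂(volume.restrict (Ioo a b)), hbar x = k x := by
      have hm : Measurable fun x => ‖hbar x - k x‖ₑ ^ 2 :=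
        ((hbar_min.1.memH1.continuous.sub hkc.memH1.continuous).measurable.enorm).pow_const 2
      filter_upwards [(lintegral_eq_zero_iff hm).1 (le_antisymm hD'b zero_le)] with x hx
      simpa [sub_eq_zero] using hx
    obtain ⟨hki, hkint⟩ := Epitaxy.integrable_and_integral_eq_of_competitor hfi hkc hkf
    have hDle := hmin.rescaled_excess_le hC hT hs0 hfe hkc.memH1 hki hkint (fun x => by
      by_cases hx : x ∈ Ioo a b
      · exact Or.inr ⟨hfs x hx, hks x hx⟩
      · exact Or.inl (hkf x hx)) (D := D) (by
      rw [Epitaxy.surfaceEnergy_eq_add_compl measurableSet_Ioo f,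
        Epitaxy.surfaceEnergy_eq_add_compl measurableSet_Ioo k, hkE, hD]
      ring)
    refine Epitaxy.eLpNorm_two_le_of_lintegral_le (by positivity) ?_
    have hcongr : ∫⁻ x in Ioo a b, ‖f x - hbar x‖ₑ ^ 2 = ∫⁻ x in Ioo a b, ‖f x - k x‖ₑ ^ 2 := by
      refine lintegral_congr_ae ?_
      filter_upwards [hae] with x hx
      rw [hx]
    rw [hcongr]
    refine hDf.trans ((mul_le_mul_right hDle _).trans ?_)
    rw [← ENNReal.ofReal_mul (by positivity)]
    refine ENNReal.ofReal_le_ofReal ?_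
    have hbaε : b - a ≤ 1 / ε := by
      rw [hf1] at hlen
      exact hlen.trans (one_div_le_one_div_of_le hε hs)
    have hexp : T * Real.exp (-(s ^ 2 * T / 4)) ≤ 8 / ε ^ 2 * Real.exp (-(ε ^ 2 * T / 8)) := by
      have h1 := Epitaxy.mul_exp_neg_le (x := T) (c := ε ^ 2 / 4) (by positivity)
      have h2 : Real.exp (-(s ^ 2 * T / 4)) ≤ Real.exp (-(ε ^ 2 / 4 * T)) := by
        refine Real.exp_le_exp.2 (neg_le_neg ?_)
        have : ε ^ 2 ≤ s ^ 2 := by gcongr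
        nlinarith
      refine (mul_le_mul_of_nonneg_left h2 hT.le).trans (h1.trans (le_of_eq ?_))
      congr 1
      · field_simp; norm_num
      · congr 1; ring
    calc (b - a) ^ 2 * (C * T * Real.exp (-(s ^ 2 * T / 4)))
        ≤ (1 / ε) ^ 2 * (C * (8 / ε ^ 2 * Real.exp (-(ε ^ 2 * T / 8)))) := by
          rw [mul_assoc C]
          have : 0 ≤ b - a := by linarith
          gcongr
      _ = (√(8 * C) / ε ^ 2 * Real.exp (-(ε ^ 2 / 16) * T)) ^ 2 := by
          rw [mul_pow, div_pow √(8 * C), Real.sq_sqrt (by positivity), ← Real.exp_nat_mul]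
          have : ((2 : ℕ) : ℝ) * (-(ε ^ 2 / 16) * T) = -(ε ^ 2 * T / 8) := by push_cast; ring
          rw [this]
          field_simp
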